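/- Let $1\le K\le M$ be integers and let $\pi_1,\dots,\pi_M\in(0,1)$ with $\sum_m\pi_m=1$. Let $f\ne g$ be probability distributions with $D(g\|f)<\infty$ and $D(f\|g)<\infty$, where $D$ is the Kullback–Leibler divergence. A target is in exactly one of $M$ cells; $H_m$ is the hypothesis that it is in cell $m$, with prior probability $\pi_m$. At each time $n=1,2,\dots$ the decision maker selects $K$ distinct cells, possibly at random, with a distribution that depends on the past selections and observations. He receives from each selected cell an observation, which has law $g$ if the cell contains the target and law $f$ otherwise, the observations being independent given the selections. A strategy $\Gamma=(\tau,\delta,\phi)$ consists of such a selection rule $\phi$, a stopping time $\tau$ of the history of selections and observations, and a declared cell $\delta$ that depends on the history up to $\tau$. With cost $c>0$ per time step its Bayes risk is $$R(\Gamma)=\sum_{m=1}^M\pi_m\bigl(\mathbf P_m(\delta\ne m)+c\,\mathbf E_m(\tau)\bigr).$$ Let $S_j(n)$ be the sum of the log-likelihood ratios $\log\frac{g(y)}{f(y)}$ over the observations $y$ taken from cell $j$ up to time $n$. The (randomized) Chernoff test with cost $c\in(0,1)$ is defined as follows. Given the history up to time $n$, let $\hat\imath$ be a maximum likelihood estimate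 of the true hypothesis, that is, a cell with maximal $S_j(n)$. The next selection is drawn from a probability distribution $q$ on the selections $u$ that maximizes $$\min_{j\ne\hat\imath}\ \sum_u q(u)\,D\bigl(p^u_{\hat\imath}\,\|\,p^u_j\bigr),$$ where $p^u_j$ is the law of the observations under $H_j$ when the cells $u$ are selected. The test stops at the first $n$ at which the difference $\Delta S(n)$ between the highest and the second highest of $S_1(n),\dots,S_M(n)$ is at least $-\log c$, and it declares the cell with the highest sum. Ties, between estimates and between maximizers, may be resolved in any measurable way. Let $$I^*(M,K)=\begin{cases}D(g\|f)+D(f\|g),&K=M,\\[2pt] \max\Bigl[\dfrac{K\,D(f\|g)}{M-1},\ D(g\|f)+\dfrac{(K-1)\,D(f\|g)}{M-1}\Bigr],&K<M.\end{cases}$$ Then Chernoff tests exist for every $c\in(0,1)$, and the Chernoff test is asymptotically optimal: its Bayes risk $R_{CT}$ satisfies $$R_{CT}\ \sim\ \frac{-c\log c}{I^*(M,K)}\ \sim\ \inf_\Gamma R(\Gamma)\qquad\text{as } c\to0^+,$$ where the infimum is over all strategies and $a\sim b$ means $a/b\to1$. No uniform exploration is added to the test, although some pairs of hypotheses have zero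 Kullback–Leibler divergence under some selections whenever $M-K\ge 2$. -/

import Mathlib

open MeasureTheory ProbabilityTheory InformationTheory Filter Topology
open scoped ENNReal

noncomputable section

namespace AnomalyDetection

/-- A selection (experiment): an ordered choice of `K` distinct cells out of `M`. -/
abbrev Action (M K : ℕ) : Type := Fin K ↪ Fin M

/-- The finite set of selections carries the discrete σ-algebra. -/
instance instMeasurableSpaceAction (M K : ℕ) : MeasurableSpace (Action M K) := ⊤

instance instDiscreteAction (M K : ℕ) : DiscreteMeasurableSpace (Action M K) :=
  ⟨fun _ => trivial⟩

/-- What the decision maker learns in one time step: the selected cells, and the vector of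
observations from them (the `i`-th entry is the observation of the `i`-th selected cell). -/
abbrev Step (M K : ℕ) (Y : Type*) : Type _ := Action M K × (Fin K → Y)

section Strategy

variable (M K : ℕ) (Y : Type*) [MeasurableSpace Y]

/-- An admissible strategy `Γ = (τ, δ, φ)`. A history `h : Fin n → Step M K Y` consists of the
selections and the observations of the first `n` time steps.

* `select n h` is the probability mass function from which the selection of step `n + 1` is drawn
  after the history `h` (a randomized selection rule; Dirac masses give the deterministic ones);
* the search stops after `n` observation steps, for the first `n` such that the history of length
  `n` lies in `halt n` (thus `τ` is a stopping time of the filtration of the histories, and every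
  such stopping time has this form);
* `decide n h` is the cell declared when the search stops with the history `h`. -/
structure Strategy where
  select : ∀ n : ℕ, Kernel (Fin n → Step M K Y) (Action M K)
  select_markov : ∀ n, IsMarkovKernel (select n)
  halt : ∀ n : ℕ, Set (Fin n → Step M K Y)
  measurableSet_halt : ∀ n, MeasurableSet (halt n)
  decide : ∀ n : ℕ, (Fin n → Step M K Y) → Fin M
  measurable_decide : ∀ n, Measurable (decide n)

end Strategy

attribute [instance] Strategy.select_markov

variable {M K : ℕ} {Y : Type*} [MeasurableSpace Y]

/-- The history of the first `n` steps along a trajectory. -/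
def history (n : ℕ) (ω : ℕ → Step M K Y) : Fin n → Step M K Y := fun i => ω i

/-- A trajectory given at the indices `0, …, n`, seen as a history of length `n + 1`. -/
def toHistory (n : ℕ) (x : (i : Finset.Iic n) → Step M K Y) : Fin (n + 1) → Step M K Y :=
  fun i => x ⟨i.1, Finset.mem_Iic.2 (Nat.lt_succ_iff.1 i.2)⟩

lemma measurable_toHistory (n : ℕ) : Measurable (toHistory (M := M) (K := K) (Y := Y) n) :=
  measurable_pi_lambda _ fun _ => measurable_pi_apply _

/-- The law of the vector of observations from the cells `a` under `H_m`: the entries are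
independent, with law `g` for the cell `m` of the target and `f` for the other cells. -/
def obsLaw (f g : Measure Y) (m : Fin M) (a : Action M K) : Measure (Fin K → Y) :=
  Measure.pi fun i => if a i = m then g else f

instance instIsProbabilityMeasureObsLaw (f g : Measure Y) [IsProbabilityMeasure f]
    [IsProbabilityMeasure g] (m : Fin M) (a : Action M K) :
    IsProbabilityMeasure (obsLaw f g m a) := by
  have : ∀ i, IsProbabilityMeasure (if a i = m then g else f) := fun i => by
    split_ifs <;> infer_instance
  unfold obsLaw
  infer_instance

/-- `obsLaw` as a Markov kernel from selections to observations. -/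
def obsKernel (f g : Measure Y) (m : Fin M) : Kernel (Action M K) (Fin K → Y) where
  toFun := obsLaw f g m
  measurable' := measurable_from_top

instance instIsMarkovKernelObsKernel (f g : Measure Y) [IsProbabilityMeasure f]
    [IsProbabilityMeasure g] (m : Fin M) :
    IsMarkovKernel (obsKernel (K := K) f g m) :=
  ⟨fun a => instIsProbabilityMeasureObsLaw f g m a⟩

namespace Strategy

variable (Γ : Strategy M K Y) (f g : Measure Y) [IsProbabilityMeasure f] [IsProbabilityMeasure g]
  (m : Fin M)

/-- The conditional law under `H_m` of step `n + 1` given the history of the first `n` steps: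
first a selection is drawn from `Γ.select n`, then the selected cells are observed. -/
def stepKernel (n : ℕ) : Kernel (Fin n → Step M K Y) (Step M K Y) :=
  Γ.select n ⊗ₖ Kernel.prodMkLeft (Fin n → Step M K Y) (obsKernel f g m)

instance instIsMarkovKernelStepKernel (n : ℕ) : IsMarkovKernel (Γ.stepKernel f g m n) := by
  unfold stepKernel
  infer_instance

/-- `stepKernel` with the histories of positive length indexed by `{0, …, n}`. -/
def stepKernelIic (n : ℕ) : Kernel ((i : Finset.Iic n) → Step M K Y) (Step M K Y) :=
  (Γ.stepKernel f g m (n + 1)).comap (toHistory n) (measurable_toHistory n)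

instance instIsMarkovKernelStepKernelIic (n : ℕ) :
    IsMarkovKernel (Γ.stepKernelIic f g m n) := by
  unfold stepKernelIic
  infer_instance

/-- The probability measure `𝐏_m` on the trajectories (sequences of selections and observations)
under the selection rule of `Γ`, the search being continued indefinitely. -/
def law : Measure (ℕ → Step M K Y) :=
  Kernel.trajMeasure (X := fun _ => Step M K Y)
    (Γ.stepKernel f g m 0 (fun i => i.elim0)) (Γ.stepKernelIic f g m)

/-- The stopping time `τ` (infinite if the search never stops). -/
def τ (ω : ℕ → Step M K Y) : ℕ∞ := ⨅ (n : ℕ) (_ : history n ω ∈ Γ.halt n), (n : ℕ∞)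

/-- The event that the search stops and declares the cell `m`. -/
def declares : Set (ℕ → Step M K Y) :=
  {ω | ∃ n : ℕ, Γ.τ ω = n ∧ Γ.decide n (history n ω) = m}

/-- The error probability `α_m = 𝐏_m(δ ≠ m)`. -/
def errorProb : ℝ≥0∞ := Γ.law f g m (Γ.declares m)ᶜ

/-- The expected detection time `𝐄_m(τ)`. -/
def expectedTime : ℝ≥0∞ := ∫⁻ ω, ((Γ.τ ω : ℕ∞) : ℝ≥0∞) ∂(Γ.law f g m)

/-- The average Bayes risk `R(Γ) = ∑ π_m (α_m + c 𝐄_m(τ))`. -/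
def risk (π : Fin M → ℝ) (c : ℝ) : ℝ≥0∞ :=
  ∑ m, ENNReal.ofReal (π m) *
    (Γ.errorProb f g m + ENNReal.ofReal c * Γ.expectedTime f g m)

end Strategy

variable (f g : Measure Y)

/-- The observed sum of log-likelihood ratios `S_j(n)` of the cell `j`. -/
def sumLLR {n : ℕ} (h : Fin n → Step M K Y) (j : Fin M) : ℝ :=
  ∑ t, ∑ i, if (h t).1 i = j then llr g f ((h t).2 i) else 0

/-- `H_i` is a maximum likelihood estimate of the true hypothesis. The log-likelihood of `H_i`,
relative to the case that all observations have law `f`, is `S_i(n)`; so `i` is a cell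
`m^{(1)}(n)` with the highest sum of log-likelihood ratios. -/
def IsMLEstimate {n : ℕ} (h : Fin n → Step M K Y) (i : Fin M) : Prop :=
  ∀ j, sumLLR f g h j ≤ sumLLR f g h i

/-- `ΔS(n) = max_i min_{j ≠ i} (S_i(n) - S_j(n))`, the difference between the highest and the
second highest of the sums `S_j(n)` (for `M ≥ 2`). -/
def gap {n : ℕ} (h : Fin n → Step M K Y) : ℝ :=
  ⨆ i : Fin M, ⨅ j : {j : Fin M // j ≠ i}, (sumLLR f g h i - sumLLR f g h j)

/-- Chernoff's objective for a distribution `q` on the experiments when `H_i` is the current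
estimate: `min_{j ≠ i} ∑_u q(u) D(p_i^u ‖ p_j^u)`. -/
def chernoffObjective (i : Fin M) (q : Measure (Action M K)) : ℝ≥0∞ :=
  ⨅ (j : Fin M) (_ : j ≠ i), ∑ u, q {u} * klDiv (obsLaw f g i u) (obsLaw f g j u)

/-- `q` maximizes Chernoff's objective among all distributions on the experiments. -/
def IsChernoffDesign (i : Fin M) (q : Measure (Action M K)) : Prop :=
  ∀ q' : Measure (Action M K), IsProbabilityMeasure q' →
    chernoffObjective f g i q' ≤ chernoffObjective f g i q

/-- `Γ` is the Chernoff test with cost `c` per observation step: the selection is always drawn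
from a maximizer of Chernoff's objective for a maximum likelihood estimate (ties between estimates
and between maximizers are resolved arbitrarily), the search stops as soon as `ΔS(n) ≥ -log c`,
and then the cell with the highest sum of log-likelihood ratios is declared. -/
structure IsChernoffTest (c : ℝ) (Γ : Strategy M K Y) : Prop where
  select_spec : ∀ (n : ℕ) (h : Fin n → Step M K Y),
    ∃ i, IsMLEstimate f g h i ∧ IsChernoffDesign f g i (Γ.select n h)
  halt_spec : ∀ (n : ℕ) (h : Fin n → Step M K Y), h ∈ Γ.halt n ↔ -Real.log c ≤ gap f g h
  decide_spec : ∀ (n : ℕ) (h : Fin n → Step M K Y), h ∈ Γ.halt n →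
    IsMLEstimate f g h (Γ.decide n h)

/-- The rate function `I*(M,K)`. -/
def rate (M K : ℕ) : ℝ :=
  if K = M then (klDiv g f).toReal + (klDiv f g).toReal
  else max (K * (klDiv f g).toReal / (M - 1))
    ((klDiv g f).toReal + (K - 1) * (klDiv f g).toReal / (M - 1))

end AnomalyDetection

end

/-!
Throughout, `D₁ = D(g ‖ f)`, `D₂ = D(f ‖ g)`, `L = -log c`, and `I*` is the rate.

**Designs.** Under the selection `u` the divergence `D(p_i^u ‖ p_j^u)` is `D₁ 1{i ∈ u} + D₂ 1{j ∈ u}`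
(`klDiv_obsLaw`). Its average over the `M - 1` alternatives `j ≠ i` is at most `I*` for every `u`
(`average_le_rate`), and a uniform choice among the selections that contain `i`, or among those that
avoid `i`, attains `I*` against every `j` at once. Hence `I*` is the value of Chernoff's maximin
problem, and every Chernoff design reaches it (`IsChernoffDesign.rate_le`).

**Chernoff test.** Under `H_m` consider the potential `V(n) = ∑_{j ≠ m} exp (-s (S_m(n) - S_j(n)))`
for a small `s > 0`. In expectation no term ever increases. If `m` is the maximum likelihood
estimate, then every term contracts by about `1 - s I*`. If the estimate is a wrong cell `i`, then
the design still separates `i` from `m`, and the term of `i`, which contracts, is the largest one.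
So `V` decays exponentially without any forced exploration, although single terms may stall. As
`V(n) ≥ 1` whenever `m` is not the unique estimate, the target leads from some time on, and this
time has exponential tails; from then on the decay at the full rate gives
`E_m τ ≤ L / β + C` for every `β < I*`, with `C` independent of `c` (`exists_expectedTime_le`). Only
the first moments of the log-likelihood ratios are needed, because the moments
`E exp (-s X)` concern their lower tails (`eventually_integral_exp_neg_mul_le`). A change of measure
bounds the error probabilities by a multiple of `c` (`IsChernoffTest.errorProb_le`).

**Lower bound.** For any strategy, the average of `S_m - S_j` over `j ≠ m` gains at most `I*` per
step in expectation under `H_m` (`sum_integral_stoppedLLR_le`), while its value at the time `τ` has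
to be large if the error probabilities are small (`le_integral_stoppedLLR`). A strategy with a risk
of the order `-c log c` therefore has `E_m τ ≥ (1 - o(1)) L / I*` (`eventually_le_risk`).
-/

namespace AnomalyDetection

section

/-! ### Likelihood ratios and divergences of a single step -/

section Density

variable {Ω : Type*} [MeasurableSpace Ω]

/-- If `dν/dμ = exp (-X)`, then `D(μ ‖ ν)` is the mean of `X` under `μ`. -/
lemma klDiv_withDensity_exp_neg {μ ν : Measure Ω} [IsProbabilityMeasure μ]
    [IsProbabilityMeasure ν] {X : Ω → ℝ} (hX : Measurable X) (hint : Integrable X μ)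
    (hν : ν = μ.withDensity fun ω => ENNReal.ofReal (Real.exp (-X ω))) :
    klDiv μ ν = ENNReal.ofReal (∫ ω, X ω ∂μ) := by
  have hmeas : Measurable fun ω => ENNReal.ofReal (Real.exp (-X ω)) := by fun_prop
  have hac : μ ≪ ν := by
    rw [hν]
    refine withDensity_absolutelyContinuous' hmeas.aemeasurable (ae_of_all _ fun ω => ?_)
    simpa using Real.exp_pos _
  have hllr : llr μ ν =ᵐ[μ] X := by
    have h2 : ν.rnDeriv μ =ᵐ[μ] fun ω => ENNReal.ofReal (Real.exp (-X ω)) := by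
      rw [hν]; exact Measure.rnDeriv_withDensity μ hmeas
    filter_upwards [neg_llr hac, h2] with ω h1 h2
    have h3 : llr ν μ ω = -X ω := by
      rw [llr, h2, ENNReal.toReal_ofReal (Real.exp_pos _).le, Real.log_exp]
    rw [h3] at h1
    simpa using h1
  have hint' : Integrable (llr μ ν) μ := hint.congr hllr.symm
  rw [← ENNReal.ofReal_toReal (klDiv_ne_top hac hint'),
    toReal_klDiv_of_measure_eq hac (by simp), integral_congr_ae hllr]

lemma withDensity_exp_llr {μ ν : Measure Ω} [IsProbabilityMeasure μ] [IsProbabilityMeasure ν]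
    (h : μ ≪ ν) (h' : ν ≪ μ) :
    ν.withDensity (fun ω => ENNReal.ofReal (Real.exp (llr μ ν ω))) = μ := by
  rw [← Measure.withDensity_rnDeriv_eq μ ν h]
  conv_lhs => rw [Measure.withDensity_rnDeriv_eq μ ν h]
  refine withDensity_congr_ae ?_
  filter_upwards [exp_llr_of_ac' μ ν h', Measure.rnDeriv_ne_top μ ν] with ω h1 h2
  rw [h1, ENNReal.ofReal_toReal h2]

lemma withDensity_exp_neg_llr {μ ν : Measure Ω} [IsProbabilityMeasure μ] [IsProbabilityMeasure ν]
    (h : μ ≪ ν) (h' : ν ≪ μ) :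
    μ.withDensity (fun ω => ENNReal.ofReal (Real.exp (-llr μ ν ω))) = ν := by
  rw [← Measure.withDensity_rnDeriv_eq ν μ h']
  conv_lhs => rw [Measure.withDensity_rnDeriv_eq ν μ h']
  refine withDensity_congr_ae ?_
  filter_upwards [exp_neg_llr h, Measure.rnDeriv_ne_top ν μ] with ω h1 h2
  rw [h1, ENNReal.ofReal_toReal h2]

lemma pi_withDensity {ι : Type*} [Fintype ι] {μ ν : ι → Measure Ω}
    [∀ i, IsProbabilityMeasure (μ i)] [∀ i, IsProbabilityMeasure (ν i)] {d : ι → Ω → ℝ≥0∞}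
    (hd : ∀ i, Measurable (d i)) (hν : ∀ i, (μ i).withDensity (d i) = ν i) :
    (Measure.pi μ).withDensity (fun y => ∏ i, d i (y i)) = Measure.pi ν := by
  refine (Measure.pi_eq fun s hs => ?_).symm
  rw [withDensity_apply _ (MeasurableSet.univ_pi hs),
    ← lintegral_indicator (MeasurableSet.univ_pi hs)]
  have h1 : ∀ y : ι → Ω, (Set.univ.pi s).indicator (fun y => ∏ i, d i (y i)) y
      = ∏ i, (s i).indicator (d i) (y i) := by
    intro y
    by_cases hy : y ∈ Set.univ.pi s
    · rw [Set.indicator_of_mem hy]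
      exact Finset.prod_congr rfl fun i _ => (Set.indicator_of_mem (hy i trivial) _).symm
    · rw [Set.indicator_of_notMem hy]
      simp only [Set.mem_univ_pi, not_forall] at hy
      obtain ⟨i, hi⟩ := hy
      exact (Finset.prod_eq_zero (Finset.mem_univ i) (Set.indicator_of_notMem hi _)).symm
  simp_rw [h1]
  have hm : ∀ i, Measurable ((s i).indicator (d i)) := fun i => (hd i).indicator (hs i)
  rw [lintegral_prod_eq_prod_lintegral_of_indepFun Finset.univ
    (fun i (y : ι → Ω) => (s i).indicator (d i) (y i))
    (iIndepFun_pi (X := fun i => (s i).indicator (d i)) fun i => (hm i).aemeasurable)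
    (fun i => (hm i).comp (measurable_pi_apply i))]
  refine Finset.prod_congr rfl fun i _ => ?_
  rw [← hν i, withDensity_apply _ (hs i), ← lintegral_indicator (hs i)]
  exact (measurePreserving_eval μ i).lintegral_comp (hm i)

end Density

variable {M K : ℕ} {Y : Type*} [MeasurableSpace Y]

/-- The contribution of a single step to the sum of log-likelihood ratios of the cell `j`. -/
noncomputable def stepLLR (f g : Measure Y) (s : Step M K Y) (j : Fin M) : ℝ :=
  ∑ i, if s.1 i = j then llr g f (s.2 i) else 0

/-- The number (`0` or `1`) of times that the cell `j` occurs in the selection `u`. -/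
def occ (u : Action M K) (j : Fin M) : ℝ := ∑ i, if u i = j then 1 else 0

lemma occ_nonneg (u : Action M K) (j : Fin M) : 0 ≤ occ u j :=
  Finset.sum_nonneg fun i _ => by split_ifs <;> norm_num

lemma occ_of_mem {u : Action M K} {i : Fin K} {j : Fin M} (h : u i = j) : occ u j = 1 := by
  unfold occ
  rw [Finset.sum_eq_single i]
  · simp [h]
  · intro k _ hk
    rw [if_neg]
    intro hk'
    exact hk (u.injective (hk'.trans h.symm))
  · simp

lemma occ_of_notMem {u : Action M K} {j : Fin M} (h : ¬ ∃ i, u i = j) : occ u j = 0 :=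
  Finset.sum_eq_zero fun i _ => if_neg fun hi => h ⟨i, hi⟩

lemma sum_occ (u : Action M K) : ∑ j, occ u j = K := by
  unfold occ
  rw [Finset.sum_comm]
  simp

section

variable {f g : Measure Y}

lemma measurable_stepLLR (j : Fin M) :
    Measurable fun s : Step M K Y => stepLLR f g s j := by
  unfold stepLLR
  refine Finset.measurable_sum _ fun i _ => ?_
  refine Measurable.ite ?_ ((measurable_llr g f).comp (by fun_prop)) measurable_const
  exact measurable_fst (MeasurableSet.of_discrete (s := {u : Action M K | u i = j}))

lemma measurable_stepLLR_right (u : Action M K) (j : Fin M) :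
    Measurable fun y : Fin K → Y => stepLLR f g (u, y) j :=
  (measurable_stepLLR j).comp measurable_prodMk_left

variable [IsProbabilityMeasure f] [IsProbabilityMeasure g]

lemma withDensity_exp_llr_ite (hgf : g ≪ f) (hfg : f ≪ g) (p q : Prop) [Decidable p]
    [Decidable q] :
    (if p then g else f).withDensity (fun y => ENNReal.ofReal
      (Real.exp (-((if p then llr g f y else 0) - (if q then llr g f y else 0)))))
      = if q then g else f := by
  by_cases h1 : p <;> by_cases h2 : q
  · simp [h1, h2]
  · simpa [h1, h2] using withDensity_exp_neg_llr hgf hfg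
  · simpa [h1, h2] using withDensity_exp_llr hgf hfg
  · simp [h1, h2]

/-- The likelihood ratio of `H_j` against `H_m` given the selection is the exponential of the
difference of the contributions to `S_j` and `S_m`. -/
lemma obsLaw_withDensity (hgf : g ≪ f) (hfg : f ≪ g) (m j : Fin M) (u : Action M K) :
    (obsLaw f g m u).withDensity
      (fun y => ENNReal.ofReal (Real.exp (-(stepLLR f g (u, y) m - stepLLR f g (u, y) j))))
      = obsLaw f g j u := by
  set d : Fin K → Y → ℝ := fun i y =>
    (if u i = m then llr g f y else 0) - (if u i = j then llr g f y else 0) with hd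
  have h1 : ∀ y : Fin K → Y,
      ENNReal.ofReal (Real.exp (-(stepLLR f g (u, y) m - stepLLR f g (u, y) j)))
        = ∏ i, ENNReal.ofReal (Real.exp (-(d i (y i)))) := by
    intro y
    rw [← ENNReal.ofReal_prod_of_nonneg fun i _ => (Real.exp_pos _).le, ← Real.exp_sum,
      Finset.sum_neg_distrib]
    simp only [stepLLR, hd, Finset.sum_sub_distrib]
  have hdm : ∀ i, Measurable (d i) := by
    intro i
    simp only [hd]
    have := measurable_llr g f
    split_ifs <;> fun_prop
  simp_rw [h1]
  have hp : ∀ (k : Fin M) (i : Fin K), IsProbabilityMeasure (if u i = k then g else f) :=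
    fun k i => by split_ifs <;> infer_instance
  have hp1 := hp m
  have hp2 := hp j
  refine pi_withDensity (d := fun i y => ENNReal.ofReal (Real.exp (-(d i y))))
    (fun i => by have := hdm i; fun_prop) fun i => ?_
  exact withDensity_exp_llr_ite hgf hfg (u i = m) (u i = j)

/-- The mean of a single log-likelihood ratio `log (g / f)` under `g` or under `f`. -/
lemma integral_llr_swap (hgf : klDiv g f ≠ ∞) (hfg : klDiv f g ≠ ∞) :
    Integrable (llr g f) g ∧ Integrable (llr g f) f ∧
      ∫ y, llr g f y ∂g = (klDiv g f).toReal ∧ ∫ y, llr g f y ∂f = -(klDiv f g).toReal := by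
  obtain ⟨h1, h2⟩ := klDiv_ne_top_iff.1 hgf
  obtain ⟨h3, h4⟩ := klDiv_ne_top_iff.1 hfg
  have h5 : (fun y => -llr f g y) =ᵐ[f] llr g f := neg_llr h3
  refine ⟨h2, h4.neg.congr h5, (toReal_klDiv_of_measure_eq h1 (by simp)).symm, ?_⟩
  rw [← integral_congr_ae h5, integral_neg, toReal_klDiv_of_measure_eq h3 (by simp)]

/-- The drift of `S_j` in one step under `H_m`: a selected cell contributes `D(g ‖ f)` if it holds
the target and `-D(f ‖ g)` otherwise. -/
lemma integral_stepLLR (hgf : klDiv g f ≠ ∞) (hfg : klDiv f g ≠ ∞) (m j : Fin M)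
    (u : Action M K) :
    Integrable (fun y => stepLLR f g (u, y) j) (obsLaw f g m u) ∧
      ∫ y, stepLLR f g (u, y) j ∂(obsLaw f g m u)
        = occ u j * (if j = m then (klDiv g f).toReal else -(klDiv f g).toReal) := by
  obtain ⟨hi1, hi2, he1, he2⟩ := integral_llr_swap hgf hfg
  have hp : ∀ (i : Fin K), IsProbabilityMeasure (if u i = m then g else f) :=
    fun i => by split_ifs <;> infer_instance
  have hcoord : ∀ i, Integrable (fun y : Fin K → Y => if u i = j then llr g f (y i) else 0)
      (obsLaw f g m u) ∧ ∫ y, (if u i = j then llr g f (y i) else 0) ∂(obsLaw f g m u)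
        = (if u i = j then 1 else 0) *
          (if j = m then (klDiv g f).toReal else -(klDiv f g).toReal) := by
    intro i
    by_cases h : u i = j
    · simp only [h, if_true, one_mul]
      have hmp := measurePreserving_eval (fun i => if u i = m then g else f) i
      have hl : Integrable (llr g f) (if u i = m then g else f) := by
        split_ifs <;> assumption
      refine ⟨hmp.integrable_comp_of_integrable hl, ?_⟩
      have h2 : ∫ y, llr g f (y i) ∂(obsLaw f g m u)
          = ∫ y, llr g f y ∂(if u i = m then g else f) := by
        have h3 := integral_map (μ := obsLaw f g m u) (φ := Function.eval i)
          (measurable_pi_apply i).aemeasurable (f := llr g f)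
          (measurable_llr g f).aestronglyMeasurable
        rw [← h3]
        unfold obsLaw
        rw [hmp.map_eq]
      rw [h2, ← h]
      split_ifs <;> assumption
    · simp [h]
  constructor
  · exact integrable_finsetSum _ fun i _ => (hcoord i).1
  · unfold stepLLR occ
    rw [integral_finsetSum _ fun i _ => (hcoord i).1, Finset.sum_mul]
    exact Finset.sum_congr rfl fun i _ => (hcoord i).2

lemma integral_stepLLR_sub (hgf : klDiv g f ≠ ∞) (hfg : klDiv f g ≠ ∞) {m j : Fin M}
    (hj : j ≠ m) (u : Action M K) :
    Integrable (fun y => stepLLR f g (u, y) m - stepLLR f g (u, y) j) (obsLaw f g m u) ∧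
    ∫ y, (stepLLR f g (u, y) m - stepLLR f g (u, y) j) ∂(obsLaw f g m u)
      = occ u m * (klDiv g f).toReal + occ u j * (klDiv f g).toReal := by
  obtain ⟨h1, h2⟩ := integral_stepLLR hgf hfg m m u
  obtain ⟨h3, h4⟩ := integral_stepLLR hgf hfg m j u
  refine ⟨h1.sub h3, ?_⟩
  rw [integral_sub h1 h3, h2, h4, if_pos rfl, if_neg hj]
  ring

/-- The divergence between two hypotheses under a selection: only the two cells in question
contribute. -/
lemma klDiv_obsLaw (hgf : klDiv g f ≠ ∞) (hfg : klDiv f g ≠ ∞) {m j : Fin M}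
    (hj : j ≠ m) (u : Action M K) :
    klDiv (obsLaw f g m u) (obsLaw f g j u)
      = ENNReal.ofReal (occ u m * (klDiv g f).toReal + occ u j * (klDiv f g).toReal) := by
  obtain ⟨h1, h2⟩ := integral_stepLLR_sub hgf hfg hj u
  rw [← h2]
  exact klDiv_withDensity_exp_neg
    ((measurable_stepLLR_right u m).sub (measurable_stepLLR_right u j)) h1
    (obsLaw_withDensity (klDiv_ne_top_iff.1 hgf).1 (klDiv_ne_top_iff.1 hfg).1 m j u).symm

end

end

section

/-! ### Exponential moments with a finite first moment -/

section ExponentialMoments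

variable {Ω : Type*} [MeasurableSpace Ω] {ν : Measure Ω} [IsProbabilityMeasure ν] {X : Ω → ℝ}

lemma exp_neg_mul_le {s : ℝ} (hs0 : 0 ≤ s) (hs1 : s ≤ 1) (x : ℝ) :
    Real.exp (-(s * x)) ≤ (1 - s) + s * Real.exp (-x) := by
  have h := convexOn_exp.2 (Set.mem_univ (0 : ℝ)) (Set.mem_univ (-x)) (sub_nonneg.2 hs1) hs0
    (by ring)
  simpa using h

lemma integrable_exp_neg_mul (hX : Measurable X)
    (hexp : Integrable (fun ω => Real.exp (-X ω)) ν) {s : ℝ} (hs0 : 0 ≤ s) (hs1 : s ≤ 1) :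
    Integrable (fun ω => Real.exp (-(s * X ω))) ν := by
  refine Integrable.mono' ((integrable_const (1 - s)).add (hexp.const_mul s))
    (by fun_prop) (ae_of_all _ fun ω => ?_)
  rw [Real.norm_eq_abs, abs_of_pos (Real.exp_pos _)]
  exact exp_neg_mul_le hs0 hs1 _

lemma integral_exp_neg_mul_le_one (hX : Measurable X)
    (hexp : Integrable (fun ω => Real.exp (-X ω)) ν) (hone : ∫ ω, Real.exp (-X ω) ∂ν ≤ 1)
    {s : ℝ} (hs0 : 0 ≤ s) (hs1 : s ≤ 1) :
    ∫ ω, Real.exp (-(s * X ω)) ∂ν ≤ 1 := by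
  calc ∫ ω, Real.exp (-(s * X ω)) ∂ν ≤ ∫ ω, ((1 - s) + s * Real.exp (-X ω)) ∂ν :=
        integral_mono (integrable_exp_neg_mul hX hexp hs0 hs1)
          ((integrable_const (1 - s)).add (hexp.const_mul s)) fun ω => exp_neg_mul_le hs0 hs1 _
    _ = (1 - s) + s * ∫ ω, Real.exp (-X ω) ∂ν := by
        rw [integral_add (integrable_const _) (hexp.const_mul s), integral_const_mul]
        simp
    _ ≤ 1 := by nlinarith

/-- To first order in `s`, the exponential moment `E exp (-s X)` is at most `1 - s E X`. The
quotient `(exp (-s X) - 1) / s` lies between `-X` and `exp (-X) - 1` by convexity, so that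
dominated convergence needs no second moment of `X`. -/
lemma eventually_integral_exp_neg_mul_le (hX : Measurable X) (hint : Integrable X ν)
    (hexp : Integrable (fun ω => Real.exp (-X ω)) ν) {ε : ℝ} (hε : 0 < ε) :
    ∀ᶠ s in 𝓝[>] (0 : ℝ),
      ∫ ω, Real.exp (-(s * X ω)) ∂ν ≤ 1 - s * (∫ ω, X ω ∂ν - ε) := by
  have hIoc : ∀ᶠ s in 𝓝[>] (0 : ℝ), s ∈ Set.Ioc (0 : ℝ) 1 := Ioc_mem_nhdsGT one_pos
  have hlim : Tendsto (fun s : ℝ => ∫ ω, (Real.exp (-(s * X ω)) - 1) / s ∂ν) (𝓝[>] 0)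
      (𝓝 (∫ ω, -X ω ∂ν)) := by
    refine tendsto_integral_filter_of_dominated_convergence
      (fun ω => |X ω| + (Real.exp (-X ω) + 1)) (.of_forall fun s => by fun_prop) ?_
      (hint.abs.add (hexp.add (integrable_const 1))) ?_
    · filter_upwards [hIoc] with s hs
      refine ae_of_all _ fun ω => ?_
      have h1 : (Real.exp (-(s * X ω)) - 1) / s ≤ Real.exp (-X ω) - 1 := by
        rw [div_le_iff₀ hs.1]
        linarith [exp_neg_mul_le hs.1.le hs.2 (X ω)]
      have h2 : -X ω ≤ (Real.exp (-(s * X ω)) - 1) / s := by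
        rw [le_div_iff₀ hs.1]
        linarith [Real.add_one_le_exp (-(s * X ω))]
      rw [Real.norm_eq_abs, abs_le]
      constructor
      · linarith [le_abs_self (X ω), Real.exp_pos (-X ω)]
      · linarith [abs_nonneg (X ω)]
    · refine ae_of_all _ fun ω => ?_
      have hd : HasDerivAt (fun s : ℝ => Real.exp (-(s * X ω))) (-X ω) 0 := by
        have h := (((hasDerivAt_id (0 : ℝ)).mul_const (X ω)).neg).exp
        simpa using h
      have h := hd.tendsto_slope_zero_right
      refine h.congr fun s => ?_
      simp [div_eq_inv_mul]
  have hlt : ∫ ω, -X ω ∂ν < -(∫ ω, X ω ∂ν - ε) := by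
    rw [integral_neg]; linarith
  filter_upwards [hlim.eventually_lt_const hlt, hIoc] with s h1 hs
  have h2 : ∫ ω, (Real.exp (-(s * X ω)) - 1) / s ∂ν
      = (∫ ω, Real.exp (-(s * X ω)) ∂ν - 1) / s := by
    rw [integral_div, integral_sub (integrable_exp_neg_mul hX hexp hs.1.le hs.2)
      (integrable_const _)]
    simp
  rw [h2, div_lt_iff₀ hs.1] at h1
  linarith

end ExponentialMoments

/-! ### The rate and the Chernoff designs -/

variable {M K : ℕ} {Y : Type*} [MeasurableSpace Y] {f g : Measure Y}

lemma toReal_klDiv_pos {μ ν : Measure Y} [IsProbabilityMeasure μ] [IsProbabilityMeasure ν]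
    (hne : μ ≠ ν) (h : klDiv μ ν ≠ ∞) : 0 < (klDiv μ ν).toReal :=
  ENNReal.toReal_pos (fun h0 => hne (klDiv_eq_zero_iff.1 h0)) h

lemma sum_occ_erase (u : Action M K) (i : Fin M) :
    ∑ j ∈ Finset.univ.erase i, occ u j = K - occ u i := by
  rw [← sum_occ u, ← Finset.add_sum_erase _ _ (Finset.mem_univ i)]
  ring

lemma occ_eq_one_of_eq (hKM : K = M) (u : Action M K) (i : Fin M) : occ u i = 1 := by
  subst hKM
  obtain ⟨k, hk⟩ := (Finite.injective_iff_surjective.1 u.injective) i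
  exact occ_of_mem hk

lemma card_univ_erase (hM : 2 ≤ M) (i : Fin M) :
    ((Finset.univ.erase i).card : ℝ) = M - 1 := by
  rw [Finset.card_erase_of_mem (Finset.mem_univ i), Finset.card_univ, Fintype.card_fin,
    Nat.cast_sub (by omega), Nat.cast_one]

lemma natCast_sub_one_pos (hM : 2 ≤ M) : (0 : ℝ) < M - 1 := by
  have : (2 : ℝ) ≤ M := by exact_mod_cast hM
  linarith

/-- For every selection, the divergence from `H_i` averaged over the alternatives `j ≠ i` is at
most the rate. -/
lemma average_le_rate (hM : 2 ≤ M) (u : Action M K) (i : Fin M) :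
    occ u i * (klDiv g f).toReal + (K - occ u i) * (klDiv f g).toReal / (M - 1)
      ≤ rate f g M K := by
  unfold rate
  have hM1 : (0 : ℝ) < M - 1 := natCast_sub_one_pos hM
  split_ifs with h
  · rw [occ_eq_one_of_eq h u i, h, one_mul, mul_div_right_comm, div_self hM1.ne', one_mul]
  · by_cases hi : ∃ k, u k = i
    · obtain ⟨k, hk⟩ := hi
      rw [occ_of_mem hk, one_mul]
      exact le_max_right _ _
    · rw [occ_of_notMem hi, zero_mul, zero_add, sub_zero]
      exact le_max_left _ _

lemma rate_pos [IsProbabilityMeasure f] [IsProbabilityMeasure g]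
    (hM : 2 ≤ M) (hK : 1 ≤ K) (hne : f ≠ g) (hgf : klDiv g f ≠ ∞)
    (hfg : klDiv f g ≠ ∞) : 0 < rate f g M K := by
  have hM1 : (0 : ℝ) < M - 1 := natCast_sub_one_pos hM
  have hK' : (0 : ℝ) < K := by exact_mod_cast hK
  have h1 := toReal_klDiv_pos hne hfg
  have h2 := toReal_klDiv_pos hne.symm hgf
  unfold rate
  split_ifs
  · positivity
  · exact lt_max_of_lt_left (by positivity)

/-- The mean of `occ u i * D(g ‖ f) + occ u j * D(f ‖ g)` for a random selection `u` with law
`q`; for `i ≠ j` this is `∑ u, q(u) D(p_i^u ‖ p_j^u)`. -/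
noncomputable def meanDiv (f g : Measure Y) (q : Measure (Action M K)) (i j : Fin M) : ℝ :=
  ∑ u, q.real {u} * (occ u i * (klDiv g f).toReal + occ u j * (klDiv f g).toReal)

lemma div_nonneg_occ (u : Action M K) (i j : Fin M) :
    0 ≤ occ u i * (klDiv g f).toReal + occ u j * (klDiv f g).toReal :=
  add_nonneg (mul_nonneg (occ_nonneg _ _) ENNReal.toReal_nonneg)
    (mul_nonneg (occ_nonneg _ _) ENNReal.toReal_nonneg)

lemma sum_klDiv_obsLaw [IsProbabilityMeasure f] [IsProbabilityMeasure g]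
    (hgf : klDiv g f ≠ ∞) (hfg : klDiv f g ≠ ∞) (q : Measure (Action M K))
    [IsProbabilityMeasure q] {i j : Fin M} (hj : j ≠ i) :
    ∑ u, q {u} * klDiv (obsLaw f g i u) (obsLaw f g j u) = ENNReal.ofReal (meanDiv f g q i j) := by
  unfold meanDiv
  rw [ENNReal.ofReal_sum_of_nonneg fun u _ =>
    mul_nonneg measureReal_nonneg (div_nonneg_occ u i j)]
  refine Finset.sum_congr rfl fun u _ => ?_
  rw [klDiv_obsLaw hgf hfg hj, ENNReal.ofReal_mul measureReal_nonneg, ofReal_measureReal]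

lemma sum_real_singleton (q : Measure (Action M K)) [IsProbabilityMeasure q] :
    ∑ u, q.real {u} = 1 := by
  rw [sum_measureReal_singleton]
  simp

lemma sum_meanDiv_erase_le (hM : 2 ≤ M) (q : Measure (Action M K)) [IsProbabilityMeasure q]
    (i : Fin M) :
    ∑ j ∈ Finset.univ.erase i, meanDiv f g q i j ≤ (M - 1) * rate f g M K := by
  have hM1 : (0 : ℝ) < M - 1 := natCast_sub_one_pos hM
  have hcard := card_univ_erase hM i
  unfold meanDiv
  rw [Finset.sum_comm]
  calc ∑ u : Action M K, ∑ j ∈ Finset.univ.erase i,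
        q.real {u} * (occ u i * (klDiv g f).toReal + occ u j * (klDiv f g).toReal)
      ≤ ∑ u : Action M K, q.real {u} * ((M - 1) * rate f g M K) := by
        refine Finset.sum_le_sum fun u _ => ?_
        rw [← Finset.mul_sum]
        refine mul_le_mul_of_nonneg_left ?_ measureReal_nonneg
        rw [Finset.sum_add_distrib, Finset.sum_const, nsmul_eq_mul, hcard, ← Finset.sum_mul,
          sum_occ_erase]
        have h := mul_le_mul_of_nonneg_left (average_le_rate (f := f) (g := g) hM u i) hM1.le
        rw [mul_add, mul_div_cancel₀ _ hM1.ne'] at h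
        exact h
    _ = (M - 1) * rate f g M K := by
        rw [← Finset.sum_mul, sum_real_singleton, one_mul]

/-- The selection `u` with the cells renamed by the transposition of `j` and `k`. -/
def swapAction (j k : Fin M) (u : Action M K) : Action M K :=
  u.trans (Equiv.swap j k).toEmbedding

lemma occ_swapAction (j k l : Fin M) (u : Action M K) :
    occ (swapAction j k u) l = occ u (Equiv.swap j k l) := by
  unfold occ
  refine Finset.sum_congr rfl fun i _ => ?_
  have : (swapAction j k u) i = l ↔ u i = Equiv.swap j k l := by
    change Equiv.swap j k (u i) = l ↔ _
    rw [Equiv.swap_apply_eq_iff]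
  simp [this]

lemma swapAction_swapAction (j k : Fin M) (u : Action M K) :
    swapAction j k (swapAction j k u) = u := by
  ext i
  change ((Equiv.swap j k (Equiv.swap j k (u i)) : Fin M) : ℕ) = _
  rw [Equiv.swap_apply_self]

/-- Some selection contains the cell `i`, and if `K < M`, then some selection avoids it. -/
lemma exists_occ_eq (hK : 1 ≤ K) (hKM : K ≤ M) (i : Fin M) :
    (∃ u : Action M K, occ u i = 1) ∧ (K < M → ∃ u : Action M K, occ u i = 0) := by
  constructor
  · refine ⟨swapAction ⟨0, by omega⟩ i (Fin.castLEEmb hKM), ?_⟩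
    rw [occ_swapAction, Equiv.swap_apply_right]
    exact occ_of_mem (i := ⟨0, hK⟩) rfl
  · intro h
    refine ⟨swapAction ⟨K, h⟩ i (Fin.castLEEmb hKM), ?_⟩
    rw [occ_swapAction, Equiv.swap_apply_right]
    refine occ_of_notMem ?_
    rintro ⟨k, hk⟩
    have := congrArg Fin.val hk
    have h2 := k.2
    simp at this
    omega

/-- Drawing the selection uniformly among those that contain `i` (for `b = 1`) or among those that
avoid `i` (for `b = 0`) puts equal weight on all the other cells. -/
lemma exists_meanDiv_eq (hM : 2 ≤ M) (i : Fin M) (b : ℝ) (hb : ∃ u : Action M K, occ u i = b) :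
    ∃ q : Measure (Action M K), IsProbabilityMeasure q ∧ ∀ j, j ≠ i →
      meanDiv f g q i j = b * (klDiv g f).toReal + (K - b) * (klDiv f g).toReal / (M - 1) := by
  classical
  have hM1 : (0 : ℝ) < M - 1 := natCast_sub_one_pos hM
  set T : Finset (Action M K) := Finset.univ.filter fun u => occ u i = b with hT
  have hTne : T.Nonempty := by
    obtain ⟨u, hu⟩ := hb
    exact ⟨u, by simp [hT, hu]⟩
  have hTc : (0 : ℝ) < T.card := by exact_mod_cast hTne.card_pos
  refine ⟨(PMF.uniformOfFinset T hTne).toMeasure, inferInstance, ?_⟩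
  have hq : ∀ u, (PMF.uniformOfFinset T hTne).toMeasure.real {u}
      = if u ∈ T then (T.card : ℝ)⁻¹ else 0 := by
    intro u
    rw [measureReal_def, PMF.toMeasure_apply_singleton _ _ (MeasurableSet.singleton u),
      PMF.uniformOfFinset_apply]
    split_ifs <;> simp
  have hsymm : ∀ j k, j ≠ i → k ≠ i → ∑ u ∈ T, occ u j = ∑ u ∈ T, occ u k := by
    intro j k hj hk
    have hmem : ∀ u ∈ T, swapAction j k u ∈ T := by
      intro u hu
      simp only [hT, Finset.mem_filter, Finset.mem_univ, true_and] at hu ⊢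
      rw [occ_swapAction, Equiv.swap_apply_of_ne_of_ne hj.symm hk.symm, hu]
    refine Finset.sum_nbij' (swapAction j k) (swapAction j k) hmem hmem
      (fun u _ => swapAction_swapAction j k u) (fun u _ => swapAction_swapAction j k u) ?_
    intro u _
    rw [occ_swapAction, Equiv.swap_apply_right]
  have hsum : ∀ j, j ≠ i → ∑ u ∈ T, occ u j = T.card * ((K - b) / (M - 1)) := by
    intro j hj
    have h1 : ∑ k ∈ Finset.univ.erase i, ∑ u ∈ T, occ u k = (M - 1) * ∑ u ∈ T, occ u j := by
      rw [Finset.sum_congr rfl fun k hk => hsymm k j (Finset.ne_of_mem_erase hk) hj,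
        Finset.sum_const, nsmul_eq_mul, card_univ_erase hM i]
    rw [Finset.sum_comm] at h1
    have h2 : ∑ u ∈ T, ∑ k ∈ Finset.univ.erase i, occ u k = T.card * (K - b) := by
      rw [← nsmul_eq_mul, ← Finset.sum_const]
      refine Finset.sum_congr rfl fun u hu => ?_
      rw [sum_occ_erase, (Finset.mem_filter.1 hu).2]
    rw [h2] at h1
    field_simp
    linarith
  have hsum_i : ∑ u ∈ T, occ u i = T.card * b := by
    rw [← nsmul_eq_mul, ← Finset.sum_const]
    exact Finset.sum_congr rfl fun u hu => (Finset.mem_filter.1 hu).2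
  intro j hj
  unfold meanDiv
  simp_rw [hq, ite_mul, zero_mul]
  rw [Finset.sum_ite_mem, Finset.univ_inter, ← Finset.mul_sum, Finset.sum_add_distrib,
    ← Finset.sum_mul, ← Finset.sum_mul, hsum j hj, hsum_i]
  field_simp

/-- Some distribution on the selections attains the rate against every alternative. -/
lemma exists_meanDiv_eq_rate (hM : 2 ≤ M) (hK : 1 ≤ K) (hKM : K ≤ M) (i : Fin M) :
    ∃ q : Measure (Action M K), IsProbabilityMeasure q ∧ ∀ j, j ≠ i →
      meanDiv f g q i j = rate f g M K := by
  have hM1 : (0 : ℝ) < M - 1 := natCast_sub_one_pos hM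
  obtain ⟨h1, h0⟩ := exists_occ_eq hK hKM i
  obtain ⟨q, hq, hq'⟩ := exists_meanDiv_eq (f := f) (g := g) hM i 1 h1
  unfold rate
  split_ifs with h
  · refine ⟨q, hq, fun j hj => ?_⟩
    rw [hq' j hj, h, one_mul, mul_div_right_comm, div_self hM1.ne', one_mul]
  · obtain ⟨r, hr, hr'⟩ := exists_meanDiv_eq (f := f) (g := g) hM i 0 (h0 (by omega))
    rcases max_choice (K * (klDiv f g).toReal / (M - 1))
      ((klDiv g f).toReal + (K - 1) * (klDiv f g).toReal / (M - 1)) with h2 | h2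
    · refine ⟨r, hr, fun j hj => ?_⟩
      rw [h2, hr' j hj]; ring
    · refine ⟨q, hq, fun j hj => ?_⟩
      rw [h2, hq' j hj]; ring

lemma exists_rate_le_chernoffObjective [IsProbabilityMeasure f] [IsProbabilityMeasure g]
    (hM : 2 ≤ M) (hK : 1 ≤ K) (hKM : K ≤ M) (hgf : klDiv g f ≠ ∞) (hfg : klDiv f g ≠ ∞)
    (i : Fin M) :
    ∃ q : Measure (Action M K), IsProbabilityMeasure q ∧
      ENNReal.ofReal (rate f g M K) ≤ chernoffObjective f g i q := by
  obtain ⟨r, hr, hr'⟩ := exists_meanDiv_eq_rate (f := f) (g := g) hM hK hKM i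
  refine ⟨r, hr, le_iInf₂ fun k hk => ?_⟩
  rw [sum_klDiv_obsLaw hgf hfg r hk, hr' k hk]

/-- Every Chernoff design reaches the rate against every alternative to the estimate. -/
lemma IsChernoffDesign.rate_le [IsProbabilityMeasure f] [IsProbabilityMeasure g]
    (hM : 2 ≤ M) (hK : 1 ≤ K) (hKM : K ≤ M)
    (hgf : klDiv g f ≠ ∞) (hfg : klDiv f g ≠ ∞) {i : Fin M} {q : Measure (Action M K)}
    [IsProbabilityMeasure q] (h : IsChernoffDesign f g i q) {j : Fin M} (hj : j ≠ i) :
    rate f g M K ≤ meanDiv f g q i j := by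
  obtain ⟨r, hr, h1⟩ := exists_rate_le_chernoffObjective hM hK hKM hgf hfg i
  have h2 : chernoffObjective f g i q ≤ ENNReal.ofReal (meanDiv f g q i j) := by
    rw [← sum_klDiv_obsLaw hgf hfg q hj]
    exact iInf₂_le j hj
  refine (ENNReal.ofReal_le_ofReal_iff ?_).1 ((h1.trans (h r hr)).trans h2)
  exact Finset.sum_nonneg fun u _ => mul_nonneg measureReal_nonneg (div_nonneg_occ u i j)

/-- The averaging bound shows that a distribution attaining the rate is a maximizer. -/
lemma exists_isChernoffDesign [IsProbabilityMeasure f] [IsProbabilityMeasure g]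
    (hM : 2 ≤ M) (hK : 1 ≤ K) (hKM : K ≤ M)
    (hgf : klDiv g f ≠ ∞) (hfg : klDiv f g ≠ ∞) (i : Fin M) :
    ∃ q : Measure (Action M K), IsProbabilityMeasure q ∧ IsChernoffDesign f g i q := by
  obtain ⟨r, hr, h1⟩ := exists_rate_le_chernoffObjective hM hK hKM hgf hfg i
  refine ⟨r, hr, fun q hq => ?_⟩
  refine le_trans ?_ h1
  have : Nontrivial (Fin M) := Fin.nontrivial_iff_two_le.2 hM
  have hcard := card_univ_erase hM i
  have hne : (Finset.univ.erase i).Nonempty := by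
    obtain ⟨k, hk⟩ := exists_ne i
    exact ⟨k, by simp [hk]⟩
  obtain ⟨j, hj, hle⟩ := Finset.exists_le_of_sum_le (s := Finset.univ.erase i)
    (f := fun j => meanDiv f g q i j) (g := fun _ => rate f g M K) hne (by
      rw [Finset.sum_const, nsmul_eq_mul, hcard]
      exact sum_meanDiv_erase_le hM q i)
  have hj' := Finset.ne_of_mem_erase hj
  refine (iInf₂_le j hj').trans ?_
  rw [sum_klDiv_obsLaw hgf hfg q hj']
  exact ENNReal.ofReal_le_ofReal hle

end

section

/-! ### The law of the trajectories -/

variable {M K : ℕ} {Y : Type*}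

/-- A history followed by one more step. -/
def snocStep {n : ℕ} (p : (Fin n → Step M K Y) × Step M K Y) : Fin (n + 1) → Step M K Y :=
  fun i => if h : (i : ℕ) < n then p.1 ⟨i, h⟩ else p.2

lemma snocStep_history (n : ℕ) (ω : ℕ → Step M K Y) :
    snocStep (history n ω, ω n) = history (n + 1) ω := by
  funext i
  unfold snocStep history
  split_ifs with h
  · rfl
  · rw [show (i : ℕ) = n by omega]

variable [MeasurableSpace Y]

@[fun_prop]
lemma measurable_history (n : ℕ) : Measurable (history (M := M) (K := K) (Y := Y) n) :=
  measurable_pi_lambda _ fun _ => measurable_pi_apply _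

lemma measurable_snocStep {n : ℕ} :
    Measurable (snocStep (M := M) (K := K) (Y := Y) (n := n)) := by
  refine measurable_pi_lambda _ fun i => ?_
  unfold snocStep
  split_ifs <;> fun_prop

section

variable {f g : Measure Y}

@[fun_prop]
lemma measurable_sumLLR {n : ℕ} (j : Fin M) :
    Measurable fun h : Fin n → Step M K Y => sumLLR f g h j :=
  Finset.measurable_sum _ fun t _ => (measurable_stepLLR j).comp (measurable_pi_apply t)

lemma sumLLR_history_zero (ω : ℕ → Step M K Y) (j : Fin M) :
    sumLLR f g (history 0 ω) j = 0 := by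
  simp [sumLLR]

lemma sumLLR_history_succ (n : ℕ) (ω : ℕ → Step M K Y) (j : Fin M) :
    sumLLR f g (history (n + 1) ω) j
      = sumLLR f g (history n ω) j + stepLLR f g (ω n) j := by
  unfold sumLLR
  rw [Fin.sum_univ_castSucc]
  rfl

end

variable (Γ : Strategy M K Y) (f g : Measure Y) [IsProbabilityMeasure f] [IsProbabilityMeasure g]
  (m : Fin M)

instance instIsProbabilityMeasureLaw : IsProbabilityMeasure (Γ.law f g m) := by
  unfold Strategy.law
  infer_instance

lemma map_law_zero :
    (Γ.law f g m).map (fun ω => ω 0) = Γ.stepKernel f g m 0 (fun i => i.elim0) := by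
  unfold Strategy.law
  set μ₀ := Γ.stepKernel f g m 0 (fun i => i.elim0) with hμ₀
  set κ := Γ.stepKernelIic f g m
  have h : (Kernel.trajMeasure (X := fun _ => Step M K Y) μ₀ κ).map (Preorder.frestrictLe 0)
      = μ₀.map (MeasurableEquiv.piUnique _).symm := by
    rw [Kernel.trajMeasure, Measure.map_comp _ _ (by fun_prop), Kernel.traj_map_frestrictLe,
      Kernel.partialTraj_self, Measure.id_comp]
  have h2 : (fun ω : ℕ → Step M K Y => ω 0)
      = (fun x : (i : Finset.Iic 0) → Step M K Y => x ⟨0, by simp⟩)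
        ∘ (Preorder.frestrictLe (π := fun _ => Step M K Y) 0) := rfl
  rw [h2, ← Measure.map_map (by fun_prop) (by fun_prop), h, Measure.map_map (by fun_prop)
    (by fun_prop)]
  convert Measure.map_id
  ext x : 1
  rfl

/-- The defining property of the law of the trajectories: the step that follows a history has
the conditional law `Γ.stepKernel`. -/
lemma map_law_history_step (n : ℕ) :
    (Γ.law f g m).map (fun ω => (history n ω, ω n))
      = (Γ.law f g m).map (history n) ⊗ₘ Γ.stepKernel f g m n := by
  refine Measure.ext_of_lintegral _ fun H hH => ?_
  rw [Measure.lintegral_compProd hH, lintegral_map hH (by fun_prop),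
    lintegral_map hH.lintegral_kernel_prod_right' (measurable_history n)]
  cases n with
  | zero =>
    have h1 : ∀ ω : ℕ → Step M K Y, history 0 ω = fun i => i.elim0 :=
      fun ω => funext fun i => i.elim0
    simp_rw [h1]
    rw [lintegral_const, measure_univ, mul_one, ← map_law_zero,
      lintegral_map (by fun_prop) (by fun_prop)]
  | succ a =>
    have h1 : ∀ ω : ℕ → Step M K Y,
        history (a + 1) ω = toHistory a (Preorder.frestrictLe a ω) := fun ω => rfl
    have hH' : Measurable fun p : ((i : Finset.Iic a) → Step M K Y) × Step M K Y =>
        H (toHistory a p.1, p.2) :=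
      hH.comp (((measurable_toHistory a).comp measurable_fst).prodMk measurable_snd)
    have h2 := congrArg (fun μ => ∫⁻ p, H (toHistory a p.1, p.2) ∂μ)
      (Kernel.map_frestrictLe_trajMeasure_compProd_eq_map_trajMeasure
        (X := fun _ => Step M K Y) (κ := Γ.stepKernelIic f g m)
        (μ₀ := Γ.stepKernel f g m 0 (fun i => i.elim0)) (a := a))
    beta_reduce at h2
    rw [Measure.lintegral_compProd hH', lintegral_map hH' (by fun_prop),
      lintegral_map hH'.lintegral_kernel_prod_right' (by fun_prop)] at h2
    exact h2.symm

lemma lintegral_history_step (n : ℕ) {H : (Fin n → Step M K Y) × Step M K Y → ℝ≥0∞}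
    (hH : Measurable H) :
    ∫⁻ ω, H (history n ω, ω n) ∂(Γ.law f g m)
      = ∫⁻ ω, ∫⁻ s, H (history n ω, s) ∂(Γ.stepKernel f g m n (history n ω)) ∂(Γ.law f g m) := by
  rw [← lintegral_map (f := H) (g := fun ω => (history n ω, ω n)) hH (by fun_prop),
    map_law_history_step, Measure.lintegral_compProd hH,
    lintegral_map hH.lintegral_kernel_prod_right' (measurable_history n)]

/-- The step kernel as a mixture over the finite set of selections. -/
lemma lintegral_stepKernel (n : ℕ) (h : Fin n → Step M K Y) {G : Step M K Y → ℝ≥0∞}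
    (hG : Measurable G) :
    ∫⁻ s, G s ∂(Γ.stepKernel f g m n h)
      = ∑ u, (∫⁻ y, G (u, y) ∂(obsLaw f g m u)) * Γ.select n h {u} := by
  unfold Strategy.stepKernel
  rw [Kernel.lintegral_compProd _ _ _ hG, lintegral_fintype]
  rfl

variable {f g}

/-- The likelihood ratio of `H_j` against `H_m` for one step; the selection rule cancels. -/
lemma lintegral_stepKernel_change (hgf : g ≪ f) (hfg : f ≪ g) (n : ℕ) (j : Fin M)
    (h : Fin n → Step M K Y) {G : Step M K Y → ℝ≥0∞} (hG : Measurable G) :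
    ∫⁻ s, G s ∂(Γ.stepKernel f g j n h)
      = ∫⁻ s, G s * ENNReal.ofReal (Real.exp (stepLLR f g s j - stepLLR f g s m))
          ∂(Γ.stepKernel f g m n h) := by
  have hm : Measurable fun s : Step M K Y =>
      ENNReal.ofReal (Real.exp (stepLLR f g s j - stepLLR f g s m)) :=
    ENNReal.measurable_ofReal.comp
      (Real.measurable_exp.comp ((measurable_stepLLR j).sub (measurable_stepLLR m)))
  have hGm : Measurable fun s =>
      G s * ENNReal.ofReal (Real.exp (stepLLR f g s j - stepLLR f g s m)) := hG.mul hm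
  rw [lintegral_stepKernel _ _ _ _ _ _ hG, lintegral_stepKernel _ _ _ _ _ _ hGm]
  refine Finset.sum_congr rfl fun u _ => ?_
  have hGu : Measurable fun y => G (u, y) := hG.comp measurable_prodMk_left
  have hd : Measurable fun y : Fin K → Y =>
      ENNReal.ofReal (Real.exp (-(stepLLR f g (u, y) m - stepLLR f g (u, y) j))) := by
    simp only [neg_sub]
    exact hm.comp measurable_prodMk_left
  rw [← obsLaw_withDensity hgf hfg m j u, lintegral_withDensity_eq_lintegral_mul _ hd hGu]
  simp only [neg_sub, Pi.mul_apply, mul_comm]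

/-- On the histories of length `n`, the law under `H_j` has the density
`exp (S_j(n) - S_m(n))` with respect to the law under `H_m`. -/
lemma lintegral_history_change (hgf : g ≪ f) (hfg : f ≪ g) (j : Fin M) (n : ℕ)
    {F : (Fin n → Step M K Y) → ℝ≥0∞} (hF : Measurable F) :
    ∫⁻ ω, F (history n ω) ∂(Γ.law f g j)
      = ∫⁻ ω, F (history n ω) * ENNReal.ofReal
          (Real.exp (sumLLR f g (history n ω) j - sumLLR f g (history n ω) m))
          ∂(Γ.law f g m) := by
  induction n with
  | zero =>
    have h1 : ∀ ω : ℕ → Step M K Y, history 0 ω = fun i => i.elim0 :=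
      fun ω => funext fun i => i.elim0
    simp [h1, sumLLR]
  | succ n ih =>
    have hF' := hF.comp measurable_snocStep
    have hs : Measurable fun p : (Fin n → Step M K Y) × Step M K Y =>
        ENNReal.ofReal (Real.exp (stepLLR f g p.2 j - stepLLR f g p.2 m)) :=
      ENNReal.measurable_ofReal.comp (Real.measurable_exp.comp
        (((measurable_stepLLR j).comp measurable_snd).sub
          ((measurable_stepLLR m).comp measurable_snd)))
    have hd : Measurable fun p : (Fin n → Step M K Y) × Step M K Y =>
        ENNReal.ofReal (Real.exp (sumLLR f g p.1 j - sumLLR f g p.1 m)) := by fun_prop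
    have e1 : ∀ ω, F (history (n + 1) ω) = (F ∘ snocStep) (history n ω, ω n) := by
      intro ω; rw [Function.comp_apply, snocStep_history]
    have e2 : ∀ ω, F (history (n + 1) ω) * ENNReal.ofReal
        (Real.exp (sumLLR f g (history (n + 1) ω) j - sumLLR f g (history (n + 1) ω) m))
        = (fun p : (Fin n → Step M K Y) × Step M K Y => ((F ∘ snocStep) p *
          ENNReal.ofReal (Real.exp (stepLLR f g p.2 j - stepLLR f g p.2 m))) *
          ENNReal.ofReal (Real.exp (sumLLR f g p.1 j - sumLLR f g p.1 m)))
          (history n ω, ω n) := by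
      intro ω
      simp only [sumLLR_history_succ, Function.comp_apply, snocStep_history]
      rw [mul_assoc, ← ENNReal.ofReal_mul (Real.exp_pos _).le, ← Real.exp_add]
      congr 3
      ring
    refine Eq.trans ?_ ((lintegral_congr e2).trans
      (lintegral_history_step _ _ _ _ _ ((hF'.mul hs).mul hd))).symm
    rw [lintegral_congr e1, lintegral_history_step _ _ _ _ _ hF',
      ih (F := fun h => ∫⁻ s, (F ∘ snocStep) (h, s) ∂(Γ.stepKernel f g j n h))
        hF'.lintegral_kernel_prod_right']
    refine lintegral_congr fun ω => ?_
    rw [lintegral_stepKernel_change Γ m hgf hfg n j _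
      (G := fun s => (F ∘ snocStep) (history n ω, s)) (hF'.comp measurable_prodMk_left)]
    exact (lintegral_mul_const _ ((hF'.mul hs).comp measurable_prodMk_left)).symm

end

section

/-! ### Stopping times -/

section Stay

variable {M K : ℕ} {Y : Type*}

/-- The histories of length `n` whose initial segments of the lengths `t ∈ [k, n)` lie in the
sets `A t`. -/
def staySet (A : ∀ n : ℕ, Set (Fin n → Step M K Y)) (k n : ℕ) : Set (Fin n → Step M K Y) :=
  {h | ∀ t : Fin n, k ≤ t → (fun i : Fin t => h (Fin.castLE t.2.le i)) ∈ A t}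

lemma history_mem_staySet {A : ∀ n : ℕ, Set (Fin n → Step M K Y)} {k n : ℕ}
    {ω : ℕ → Step M K Y} :
    history n ω ∈ staySet A k n ↔ ∀ t, k ≤ t → t < n → history t ω ∈ A t :=
  ⟨fun h t hk ht => h ⟨t, ht⟩ hk, fun h t hk => h t hk t.2⟩

lemma measurableSet_staySet [MeasurableSpace Y] {A : ∀ n : ℕ, Set (Fin n → Step M K Y)}
    (hA : ∀ n, MeasurableSet (A n)) (k n : ℕ) : MeasurableSet (staySet A k n) := by
  have h : staySet A k n = ⋂ (t : Fin n) (_ : k ≤ t),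
      (fun h : Fin n → Step M K Y => fun i : Fin t => h (Fin.castLE t.2.le i)) ⁻¹' A t := by
    ext h
    simp [staySet]
  rw [h]
  refine MeasurableSet.iInter fun t => MeasurableSet.iInter fun _ => ?_
  exact (measurable_pi_lambda _ fun i => measurable_pi_apply _) (hA t)

end Stay

variable {M K : ℕ} {Y : Type*} [MeasurableSpace Y]

lemma natCast_toENNReal_eq_tsum (x : ℕ∞) :
    ((x : ℕ∞) : ℝ≥0∞) = ∑' n : ℕ, if (n : ℕ∞) < x then 1 else 0 := by
  induction x using ENat.recTopCoe with
  | top => simp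
  | coe k =>
    rw [tsum_eq_sum (s := Finset.range k)]
    · simp only [Nat.cast_lt]
      rw [Finset.sum_congr rfl fun n hn => if_pos (Finset.mem_range.1 hn)]
      simp
    · intro n hn
      simpa using hn

namespace Strategy

variable (Γ : Strategy M K Y)

lemma lt_τ_iff {n : ℕ} {ω : ℕ → Step M K Y} :
    (n : ℕ∞) < Γ.τ ω ↔ ∀ k ≤ n, history k ω ∉ Γ.halt k := by
  constructor
  · intro h k hk hmem
    have h1 : Γ.τ ω ≤ k := iInf₂_le k hmem
    exact absurd (h.trans_le (h1.trans (by exact_mod_cast hk))) (lt_irrefl _)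
  · intro h
    have h1 : ((n + 1 : ℕ) : ℕ∞) ≤ Γ.τ ω := by
      refine le_iInf₂ fun k hk => ?_
      have : ¬ k ≤ n := fun hkn => h k hkn hk
      exact_mod_cast (by omega : n + 1 ≤ k)
    exact lt_of_lt_of_le (by exact_mod_cast Nat.lt_succ_self n) h1

/-- The histories of length `n` along which the search has not stopped. -/
def aliveSet (n : ℕ) : Set (Fin n → Step M K Y) :=
  (Γ.halt n)ᶜ ∩ staySet (fun k => (Γ.halt k)ᶜ) 0 n

/-- The histories of length `n` with which the search stops. -/
def stopSet (n : ℕ) : Set (Fin n → Step M K Y) :=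
  Γ.halt n ∩ staySet (fun k => (Γ.halt k)ᶜ) 0 n

lemma measurableSet_aliveSet (n : ℕ) : MeasurableSet (Γ.aliveSet n) :=
  (Γ.measurableSet_halt n).compl.inter
    (measurableSet_staySet (fun k => (Γ.measurableSet_halt k).compl) 0 n)

lemma measurableSet_stopSet (n : ℕ) : MeasurableSet (Γ.stopSet n) :=
  (Γ.measurableSet_halt n).inter
    (measurableSet_staySet (fun k => (Γ.measurableSet_halt k).compl) 0 n)

lemma history_mem_aliveSet {n : ℕ} {ω : ℕ → Step M K Y} :
    history n ω ∈ Γ.aliveSet n ↔ (n : ℕ∞) < Γ.τ ω := by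
  rw [lt_τ_iff, aliveSet, Set.mem_inter_iff, history_mem_staySet]
  constructor
  · rintro ⟨h1, h2⟩ k hk
    rcases hk.lt_or_eq with h | rfl
    · exact h2 k (Nat.zero_le k) h
    · exact h1
  · exact fun h => ⟨h n le_rfl, fun t _ ht => h t ht.le⟩

lemma history_mem_stopSet {n : ℕ} {ω : ℕ → Step M K Y} :
    history n ω ∈ Γ.stopSet n ↔ Γ.τ ω = n := by
  rw [stopSet, Set.mem_inter_iff, history_mem_staySet]
  constructor
  · rintro ⟨h1, h2⟩
    refine le_antisymm (iInf₂_le n h1) (le_iInf₂ fun k hk => ?_)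
    have : ¬ k < n := fun hkn => h2 k (Nat.zero_le k) hkn hk
    exact_mod_cast not_lt.1 this
  · intro h
    have h2 : ∀ k < n, history k ω ∉ Γ.halt k := fun k hk =>
      Γ.lt_τ_iff.1 (by rw [h]; exact_mod_cast hk) k le_rfl
    refine ⟨?_, fun t _ ht => h2 t ht⟩
    by_contra h1
    have h3 : (n : ℕ∞) < Γ.τ ω := by
      refine Γ.lt_τ_iff.2 fun k hk => ?_
      rcases hk.lt_or_eq with h4 | rfl
      · exact h2 k h4
      · exact h1
    exact absurd h3 (by rw [h]; exact lt_irrefl _)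

lemma measurableSet_lt_τ (n : ℕ) : MeasurableSet {ω | (n : ℕ∞) < Γ.τ ω} := by
  have h : {ω | (n : ℕ∞) < Γ.τ ω} = history n ⁻¹' Γ.aliveSet n := by
    ext ω; exact Γ.history_mem_aliveSet.symm
  rw [h]
  exact measurable_history n (Γ.measurableSet_aliveSet n)

/-- The histories of length `n` with which the search stops, declaring the cell `m`. -/
def declareSet (m : Fin M) (n : ℕ) : Set (Fin n → Step M K Y) :=
  Γ.stopSet n ∩ Γ.decide n ⁻¹' {m}

lemma measurableSet_declareSet (m : Fin M) (n : ℕ) : MeasurableSet (Γ.declareSet m n) :=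
  (Γ.measurableSet_stopSet n).inter (Γ.measurable_decide n (MeasurableSet.singleton m))

lemma declares_eq_iUnion (m : Fin M) :
    Γ.declares m = ⋃ n, history n ⁻¹' Γ.declareSet m n := by
  ext ω
  simp only [declares, Set.mem_ofPred_eq, Set.mem_iUnion, Set.mem_preimage, declareSet,
    Set.mem_inter_iff, history_mem_stopSet, Set.mem_singleton_iff]

lemma disjoint_declareSet (m : Fin M) :
    Pairwise (Function.onFun Disjoint fun n => history n ⁻¹' Γ.declareSet m n) := by
  intro n k hnk
  refine Set.disjoint_left.2 fun ω h1 h2 => hnk ?_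
  have h3 := Γ.history_mem_stopSet.1 h1.1
  have h4 := Γ.history_mem_stopSet.1 h2.1
  exact_mod_cast h3.symm.trans h4

lemma measurableSet_declares (m : Fin M) : MeasurableSet (Γ.declares m) := by
  rw [declares_eq_iUnion]
  exact MeasurableSet.iUnion fun n => measurable_history n (Γ.measurableSet_declareSet m n)

variable (f g : Measure Y) [IsProbabilityMeasure f] [IsProbabilityMeasure g] (m : Fin M)

lemma expectedTime_eq_tsum :
    Γ.expectedTime f g m = ∑' n : ℕ, Γ.law f g m {ω | (n : ℕ∞) < Γ.τ ω} := by
  unfold expectedTime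
  simp_rw [natCast_toENNReal_eq_tsum]
  rw [lintegral_tsum fun n => (Measurable.ite (Γ.measurableSet_lt_τ n) measurable_const
    measurable_const).aemeasurable]
  refine tsum_congr fun n => ?_
  rw [← lintegral_indicator_one (Γ.measurableSet_lt_τ n)]
  refine lintegral_congr fun ω => ?_
  simp [Set.indicator_apply]

lemma measure_τ_eq_top (h : Γ.expectedTime f g m ≠ ∞) :
    Γ.law f g m {ω | Γ.τ ω = ⊤} = 0 := by
  have hτ : Measurable fun ω => ((Γ.τ ω : ℕ∞) : ℝ≥0∞) := by
    simp_rw [natCast_toENNReal_eq_tsum]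
    exact Measurable.tsum fun n => Measurable.ite (Γ.measurableSet_lt_τ n)
      measurable_const measurable_const
  have h1 := ae_lt_top hτ h
  rw [ae_iff] at h1
  simpa using h1

end Strategy

end

section

/-! ### Contraction of the exponential potential -/

variable {M K : ℕ} {Y : Type*} [MeasurableSpace Y] {f g : Measure Y}

/-- A design that separates `i` from `j` also separates `j` from `i`, up to the factor between the
two divergences of `f` and `g`. -/
lemma exists_meanDiv_swap (h1 : 0 < (klDiv g f).toReal) (h2 : 0 < (klDiv f g).toReal) :
    ∃ κ : ℝ, 0 < κ ∧ κ ≤ 1 ∧ ∀ (q : Measure (Action M K)) (i j : Fin M),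
      κ * meanDiv f g q i j ≤ meanDiv f g q j i := by
  set a := (klDiv g f).toReal
  set b := (klDiv f g).toReal
  refine ⟨min 1 (min (b / a) (a / b)), by positivity, min_le_left _ _, fun q i j => ?_⟩
  set κ := min 1 (min (b / a) (a / b))
  have hκa : κ * a ≤ b := by
    rw [← le_div_iff₀ h1]
    exact (min_le_right _ _).trans (min_le_left _ _)
  have hκb : κ * b ≤ a := by
    rw [← le_div_iff₀ h2]
    exact (min_le_right _ _).trans (min_le_right _ _)
  unfold meanDiv
  rw [Finset.mul_sum]
  refine Finset.sum_le_sum fun u _ => ?_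
  rw [mul_left_comm]
  refine mul_le_mul_of_nonneg_left ?_ measureReal_nonneg
  have h3 := mul_le_mul_of_nonneg_left hκa (occ_nonneg u i)
  have h4 := mul_le_mul_of_nonneg_left hκb (occ_nonneg u j)
  nlinarith

/-- The exponential potential `∑_{j ≠ m} exp (-s (S_m - S_j))`. -/
noncomputable def potential (f g : Measure Y) (s : ℝ) (m : Fin M) {n : ℕ}
    (h : Fin n → Step M K Y) : ℝ :=
  ∑ j ∈ Finset.univ.erase m, Real.exp (-(s * (sumLLR f g h m - sumLLR f g h j)))

lemma potential_nonneg (s : ℝ) (m : Fin M) {n : ℕ} (h : Fin n → Step M K Y) :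
    0 ≤ potential f g s m h :=
  Finset.sum_nonneg fun _ _ => (Real.exp_pos _).le

@[fun_prop]
lemma measurable_potential (s : ℝ) (m : Fin M) {n : ℕ} :
    Measurable fun h : Fin n → Step M K Y => potential f g s m h := by
  unfold potential
  fun_prop

/-- The potential is large when some wrong cell trails the cell of the target only a little. -/
lemma exp_le_potential {s L : ℝ} (hs : 0 ≤ s) {m j : Fin M} (hj : j ≠ m) {n : ℕ}
    {h : Fin n → Step M K Y} (hL : sumLLR f g h m - sumLLR f g h j ≤ L) :
    Real.exp (-(s * L)) ≤ potential f g s m h := by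
  calc Real.exp (-(s * L)) ≤ Real.exp (-(s * (sumLLR f g h m - sumLLR f g h j))) :=
        Real.exp_le_exp.2 (neg_le_neg (mul_le_mul_of_nonneg_left hL hs))
    _ ≤ potential f g s m h :=
        Finset.single_le_sum (f := fun j => Real.exp (-(s * (sumLLR f g h m - sumLLR f g h j))))
          (fun _ _ => (Real.exp_pos _).le) (Finset.mem_erase.2 ⟨hj, Finset.mem_univ j⟩)

/-- The histories along which the cell `m` is the only maximum likelihood estimate. -/
def leadSet (f g : Measure Y) (m : Fin M) (n : ℕ) : Set (Fin n → Step M K Y) :=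
  {h | ∀ j, j ≠ m → sumLLR f g h j < sumLLR f g h m}

lemma measurableSet_leadSet (m : Fin M) (n : ℕ) :
    MeasurableSet (leadSet (K := K) f g m n) := by
  have h : leadSet (K := K) f g m n = ⋂ (j : Fin M) (_ : j ≠ m),
      {h | sumLLR f g h j < sumLLR f g h m} := by
    ext h; simp [leadSet]
  rw [h]
  exact MeasurableSet.iInter fun j => MeasurableSet.iInter fun _ =>
    measurableSet_lt (measurable_sumLLR j) (measurable_sumLLR m)

variable [IsProbabilityMeasure f] [IsProbabilityMeasure g]

lemma lintegral_exp_stepLLR (hgf : g ≪ f) (hfg : f ≪ g) (m j : Fin M) (u : Action M K) :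
    ∫⁻ y, ENNReal.ofReal (Real.exp (-(stepLLR f g (u, y) m - stepLLR f g (u, y) j)))
      ∂(obsLaw f g m u) = 1 := by
  have h := congrArg (fun μ => μ Set.univ) (obsLaw_withDensity hgf hfg m j u)
  simpa using h

lemma integral_exp_stepLLR (hgf : g ≪ f) (hfg : f ≪ g) (m j : Fin M) (u : Action M K) :
    Integrable (fun y => Real.exp (-(stepLLR f g (u, y) m - stepLLR f g (u, y) j)))
      (obsLaw f g m u) ∧
    ∫ y, Real.exp (-(stepLLR f g (u, y) m - stepLLR f g (u, y) j)) ∂(obsLaw f g m u) = 1 := by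
  have hm : Measurable fun y : Fin K → Y =>
      Real.exp (-(stepLLR f g (u, y) m - stepLLR f g (u, y) j)) :=
    Real.measurable_exp.comp ((measurable_stepLLR_right u m).sub (measurable_stepLLR_right u j)).neg
  have h := lintegral_exp_stepLLR hgf hfg m j u
  have hnn : 0 ≤ᵐ[obsLaw f g m u] fun y =>
      Real.exp (-(stepLLR f g (u, y) m - stepLLR f g (u, y) j)) :=
    ae_of_all _ fun y => (Real.exp_pos _).le
  constructor
  · refine (lintegral_ofReal_ne_top_iff_integrable hm.aestronglyMeasurable hnn).1 ?_
    rw [h]; exact ENNReal.one_ne_top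
  · rw [integral_eq_lintegral_of_nonneg_ae hnn hm.aestronglyMeasurable, h, ENNReal.toReal_one]

/-- The exponent `s` is good for the tolerance `ε` if, for every selection, the exponential moment
`E_m exp (-s (x_m - x_j))` of the increments `x_m`, `x_j` of `S_m`, `S_j` in one step is at most `1`
and at most its first-order expansion with the divergence reduced by `ε`. -/
def GoodExponent (f g : Measure Y) (M K : ℕ) (ε s : ℝ) : Prop :=
  ∀ (m j : Fin M) (u : Action M K), j ≠ m →
    Integrable (fun y => Real.exp (-(s * (stepLLR f g (u, y) m - stepLLR f g (u, y) j))))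
      (obsLaw f g m u) ∧
    ∫ y, Real.exp (-(s * (stepLLR f g (u, y) m - stepLLR f g (u, y) j))) ∂(obsLaw f g m u)
      ≤ min 1 (1 - s * (occ u m * (klDiv g f).toReal + occ u j * (klDiv f g).toReal - ε))

lemma eventually_goodExponent (hgf : klDiv g f ≠ ∞) (hfg : klDiv f g ≠ ∞) {ε : ℝ} (hε : 0 < ε) :
    ∀ᶠ s in 𝓝[>] (0 : ℝ), GoodExponent f g M K ε s := by
  unfold GoodExponent
  simp only [eventually_all]
  intro m j u hj
  have hac := (klDiv_ne_top_iff.1 hgf).1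
  have hac' := (klDiv_ne_top_iff.1 hfg).1
  have hX : Measurable fun y : Fin K → Y => stepLLR f g (u, y) m - stepLLR f g (u, y) j :=
    (measurable_stepLLR_right u m).sub (measurable_stepLLR_right u j)
  obtain ⟨hint, hmean⟩ := integral_stepLLR_sub hgf hfg hj u
  obtain ⟨hexp, hone⟩ := integral_exp_stepLLR hac hac' m j u
  have hIoc : ∀ᶠ s in 𝓝[>] (0 : ℝ), s ∈ Set.Ioc (0 : ℝ) 1 := Ioc_mem_nhdsGT one_pos
  filter_upwards [eventually_integral_exp_neg_mul_le hX hint hexp hε, hIoc] with s hs hs1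
  refine ⟨integrable_exp_neg_mul hX hexp hs1.1.le hs1.2, le_min ?_ ?_⟩
  · exact integral_exp_neg_mul_le_one hX hexp hone.le hs1.1.le hs1.2
  · rw [← hmean]
    exact hs

/-- The factor `ρ` by which the term of the cell `j` of the potential below changes in expectation,
for an arbitrary strategy. -/
lemma GoodExponent.lintegral_stepKernel_le {ε s : ℝ} (hs : GoodExponent f g M K ε s)
    (Γ : Strategy M K Y) (n : ℕ) (h : Fin n → Step M K Y) {m j : Fin M} (hj : j ≠ m) :
    ∃ ρ : ℝ, 0 ≤ ρ ∧ ρ ≤ 1 ∧ ρ ≤ 1 - s * (meanDiv f g (Γ.select n h) m j - ε) ∧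
      ∫⁻ t, ENNReal.ofReal (Real.exp (-(s * (stepLLR f g t m - stepLLR f g t j))))
        ∂(Γ.stepKernel f g m n h) = ENNReal.ofReal ρ := by
  set q := Γ.select n h
  set φ : Action M K → ℝ := fun u =>
    ∫ y, Real.exp (-(s * (stepLLR f g (u, y) m - stepLLR f g (u, y) j))) ∂(obsLaw f g m u) with hφ
  have hφ0 : ∀ u, 0 ≤ φ u := fun u => integral_nonneg fun y => (Real.exp_pos _).le
  have hφ1 : ∀ u, φ u ≤ 1 := fun u => (hs m j u hj).2.trans (min_le_left _ _)
  refine ⟨∑ u, q.real {u} * φ u,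
    Finset.sum_nonneg fun u _ => mul_nonneg measureReal_nonneg (hφ0 u), ?_, ?_, ?_⟩
  · calc ∑ u, q.real {u} * φ u ≤ ∑ u, q.real {u} * 1 :=
          Finset.sum_le_sum fun u _ => mul_le_mul_of_nonneg_left (hφ1 u) measureReal_nonneg
      _ = 1 := by simp only [mul_one]; exact sum_real_singleton q
  · calc ∑ u, q.real {u} * φ u ≤ ∑ u, q.real {u} * (1 - s *
            (occ u m * (klDiv g f).toReal + occ u j * (klDiv f g).toReal - ε)) :=
          Finset.sum_le_sum fun u _ => mul_le_mul_of_nonneg_left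
            ((hs m j u hj).2.trans (min_le_right _ _)) measureReal_nonneg
      _ = ∑ u, (q.real {u} * (1 + s * ε) - s * (q.real {u} *
            (occ u m * (klDiv g f).toReal + occ u j * (klDiv f g).toReal))) :=
          Finset.sum_congr rfl fun u _ => by ring
      _ = 1 - s * (meanDiv f g q m j - ε) := by
          rw [Finset.sum_sub_distrib, ← Finset.sum_mul, sum_real_singleton, ← Finset.mul_sum,
            meanDiv]
          ring
  · have hG : Measurable fun t : Step M K Y =>
        ENNReal.ofReal (Real.exp (-(s * (stepLLR f g t m - stepLLR f g t j)))) :=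
      ENNReal.measurable_ofReal.comp (Real.measurable_exp.comp
        (((measurable_stepLLR m).sub (measurable_stepLLR j)).const_mul s).neg)
    rw [lintegral_stepKernel _ _ _ _ _ _ hG, ENNReal.ofReal_sum_of_nonneg fun u _ =>
      mul_nonneg measureReal_nonneg (hφ0 u)]
    refine Finset.sum_congr rfl fun u _ => ?_
    rw [ENNReal.ofReal_mul measureReal_nonneg, ofReal_measureReal, mul_comm, hφ,
      ofReal_integral_eq_lintegral_ofReal (hs m j u hj).1
        (ae_of_all _ fun y => (Real.exp_pos _).le)]

/-- The one-step bound for the potential: if the conditional expectation of each of its terms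
contracts so that the potential contracts by `r`, then this holds for the expectations on any
event of the past. -/
lemma lintegral_potential_succ_le {s : ℝ} (Γ : Strategy M K Y) (m : Fin M) (n : ℕ) {r : ℝ}
    (hr : 0 ≤ r) {A : Set (Fin n → Step M K Y)} (hA : MeasurableSet A)
    (hstep : ∀ h ∈ A, ∃ ρ : Fin M → ℝ, (∀ j, 0 ≤ ρ j) ∧
      (∀ j, j ≠ m → ∫⁻ t, ENNReal.ofReal
          (Real.exp (-(s * (stepLLR f g t m - stepLLR f g t j)))) ∂(Γ.stepKernel f g m n h)
          = ENNReal.ofReal (ρ j)) ∧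
      ∑ j ∈ Finset.univ.erase m,
        Real.exp (-(s * (sumLLR f g h m - sumLLR f g h j))) * ρ j ≤ r * potential f g s m h) :
    ∫⁻ ω, A.indicator 1 (history n ω) * ENNReal.ofReal (potential f g s m (history (n + 1) ω))
        ∂(Γ.law f g m)
      ≤ ENNReal.ofReal r * ∫⁻ ω, A.indicator 1 (history n ω) *
        ENNReal.ofReal (potential f g s m (history n ω)) ∂(Γ.law f g m) := by
  have hmt : ∀ j, Measurable fun t : Step M K Y =>
        ENNReal.ofReal (Real.exp (-(s * (stepLLR f g t m - stepLLR f g t j)))) := fun j =>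
      ENNReal.measurable_ofReal.comp (Real.measurable_exp.comp
        (((measurable_stepLLR m).sub (measurable_stepLLR j)).const_mul s).neg)
  have hind : Measurable (A.indicator (1 : (Fin n → Step M K Y) → ℝ≥0∞)) :=
    measurable_one.indicator hA
  set H : (Fin n → Step M K Y) × Step M K Y → ℝ≥0∞ := fun p => A.indicator 1 p.1 *
    ∑ j ∈ Finset.univ.erase m,
      ENNReal.ofReal (Real.exp (-(s * (sumLLR f g p.1 m - sumLLR f g p.1 j)))) *
      ENNReal.ofReal (Real.exp (-(s * (stepLLR f g p.2 m - stepLLR f g p.2 j)))) with hHdef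
  have hH : Measurable H := by
    refine (hind.comp measurable_fst).mul (Finset.measurable_sum _ fun j _ => ?_)
    refine Measurable.mul ?_ ((hmt j).comp measurable_snd)
    fun_prop
  have e1 : ∀ ω, A.indicator 1 (history n ω) *
      ENNReal.ofReal (potential f g s m (history (n + 1) ω)) = H (history n ω, ω n) := by
    intro ω
    rw [hHdef, potential, ENNReal.ofReal_sum_of_nonneg fun _ _ => (Real.exp_pos _).le]
    congr 1
    refine Finset.sum_congr rfl fun j _ => ?_
    rw [sumLLR_history_succ, sumLLR_history_succ, ← ENNReal.ofReal_mul (Real.exp_pos _).le,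
      ← Real.exp_add]
    congr 2
    ring
  have hm2 : Measurable fun ω : ℕ → Step M K Y => A.indicator 1 (history n ω) *
        ENNReal.ofReal (potential f g s m (history n ω)) :=
    (hind.comp (measurable_history n)).mul (by fun_prop)
  rw [lintegral_congr e1, lintegral_history_step _ _ _ _ _ hH, ← lintegral_const_mul _ hm2]
  refine lintegral_mono fun ω => ?_
  by_cases hω : history n ω ∈ A
  · obtain ⟨ρ, hρ0, hρ, hle⟩ := hstep _ hω
    simp only [hHdef, Set.indicator_of_mem hω, Pi.one_apply, one_mul]
    rw [lintegral_finsetSum _ fun j _ => (hmt j).const_mul _]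
    calc ∑ j ∈ Finset.univ.erase m, ∫⁻ t, ENNReal.ofReal (Real.exp
          (-(s * (sumLLR f g (history n ω) m - sumLLR f g (history n ω) j)))) *
          ENNReal.ofReal (Real.exp (-(s * (stepLLR f g t m - stepLLR f g t j))))
          ∂(Γ.stepKernel f g m n (history n ω))
        = ∑ j ∈ Finset.univ.erase m, ENNReal.ofReal (Real.exp
          (-(s * (sumLLR f g (history n ω) m - sumLLR f g (history n ω) j))) * ρ j) := by
          refine Finset.sum_congr rfl fun j hj => ?_
          rw [lintegral_const_mul _ (hmt j), hρ j (Finset.ne_of_mem_erase hj),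
            ← ENNReal.ofReal_mul (Real.exp_pos _).le]
      _ = ENNReal.ofReal (∑ j ∈ Finset.univ.erase m, Real.exp
          (-(s * (sumLLR f g (history n ω) m - sumLLR f g (history n ω) j))) * ρ j) :=
          (ENNReal.ofReal_sum_of_nonneg fun j _ =>
            mul_nonneg (Real.exp_pos _).le (hρ0 j)).symm
      _ ≤ ENNReal.ofReal (r * potential f g s m (history n ω)) := ENNReal.ofReal_le_ofReal hle
      _ = _ := ENNReal.ofReal_mul hr
  · simp [hHdef, Set.indicator_of_notMem hω]

/-- While the cell `m` of the target is the only maximum likelihood estimate, the Chernoff test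
contracts every term of the potential at the full rate. -/
lemma GoodExponent.lead_step {ε s : ℝ} (hs : GoodExponent f g M K ε s) (hs0 : 0 ≤ s)
    (hM : 2 ≤ M) (hK : 1 ≤ K) (hKM : K ≤ M)
    (hgf : klDiv g f ≠ ∞) (hfg : klDiv f g ≠ ∞) {Γ : Strategy M K Y} {n : ℕ}
    {h : Fin n → Step M K Y} {m : Fin M} (hd : IsChernoffDesign f g m (Γ.select n h)) :
    ∃ ρ : Fin M → ℝ, (∀ j, 0 ≤ ρ j) ∧
      (∀ j, j ≠ m → ∫⁻ t, ENNReal.ofReal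
          (Real.exp (-(s * (stepLLR f g t m - stepLLR f g t j)))) ∂(Γ.stepKernel f g m n h)
          = ENNReal.ofReal (ρ j)) ∧
      ∑ j ∈ Finset.univ.erase m, Real.exp (-(s * (sumLLR f g h m - sumLLR f g h j))) * ρ j
        ≤ (1 - s * (rate f g M K - ε)) * potential f g s m h := by
  have key : ∀ j, ∃ ρ : ℝ, 0 ≤ ρ ∧ (j ≠ m → ∫⁻ t, ENNReal.ofReal
          (Real.exp (-(s * (stepLLR f g t m - stepLLR f g t j)))) ∂(Γ.stepKernel f g m n h)
          = ENNReal.ofReal ρ) ∧ (j ≠ m → ρ ≤ 1 - s * (rate f g M K - ε)) := by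
    intro j
    by_cases hj : j = m
    · exact ⟨0, le_rfl, fun h => absurd hj h, fun h => absurd hj h⟩
    · obtain ⟨ρ, h0, -, h2, h3⟩ := hs.lintegral_stepKernel_le Γ n h hj
      refine ⟨ρ, h0, fun _ => h3, fun _ => h2.trans ?_⟩
      have := hd.rate_le hM hK hKM hgf hfg hj
      nlinarith
  choose ρ h0 h1 h2 using key
  refine ⟨ρ, h0, h1, ?_⟩
  rw [mul_comm, potential, Finset.sum_mul]
  exact Finset.sum_le_sum fun j hj =>
    mul_le_mul_of_nonneg_left (h2 j (Finset.ne_of_mem_erase hj)) (Real.exp_pos _).le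

/-- If the estimate is a wrong cell `i`, then its term is the largest one of the potential, and
the Chernoff test contracts this term; in expectation no other term increases. -/
lemma GoodExponent.wrong_step {ε s κ : ℝ} (hs : GoodExponent f g M K ε s) (hs0 : 0 ≤ s)
    (hM : 2 ≤ M) (hK : 1 ≤ K) (hKM : K ≤ M) (hgf : klDiv g f ≠ ∞) (hfg : klDiv f g ≠ ∞)
    (hκ0 : 0 ≤ κ) (hε : ε ≤ κ * rate f g M K)
    (hκ : ∀ (q : Measure (Action M K)) (i j : Fin M), κ * meanDiv f g q i j ≤ meanDiv f g q j i)
    {Γ : Strategy M K Y} {n : ℕ} {h : Fin n → Step M K Y} {m i : Fin M} (hi : i ≠ m)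
    (hML : IsMLEstimate f g h i) (hd : IsChernoffDesign f g i (Γ.select n h)) :
    ∃ ρ : Fin M → ℝ, (∀ j, 0 ≤ ρ j) ∧
      (∀ j, j ≠ m → ∫⁻ t, ENNReal.ofReal
          (Real.exp (-(s * (stepLLR f g t m - stepLLR f g t j)))) ∂(Γ.stepKernel f g m n h)
          = ENNReal.ofReal (ρ j)) ∧
      ∑ j ∈ Finset.univ.erase m, Real.exp (-(s * (sumLLR f g h m - sumLLR f g h j))) * ρ j
        ≤ (1 - s * (κ * rate f g M K - ε) / M) * potential f g s m h := by
  have key : ∀ j, ∃ ρ : ℝ, 0 ≤ ρ ∧ (j ≠ m → ∫⁻ t, ENNReal.ofReal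
          (Real.exp (-(s * (stepLLR f g t m - stepLLR f g t j)))) ∂(Γ.stepKernel f g m n h)
          = ENNReal.ofReal ρ) ∧ (j ≠ m → ρ ≤ 1) ∧
          (j = i → ρ ≤ 1 - s * (κ * rate f g M K - ε)) := by
    intro j
    by_cases hj : j = m
    · exact ⟨0, le_rfl, fun h => absurd hj h, fun h => absurd hj h,
        fun h => absurd (h.symm.trans hj) hi⟩
    · obtain ⟨ρ, h0, h1, h2, h3⟩ := hs.lintegral_stepKernel_le Γ n h hj
      refine ⟨ρ, h0, fun _ => h3, fun _ => h1, fun hji => h2.trans ?_⟩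
      subst hji
      have h4 := mul_le_mul_of_nonneg_left (hd.rate_le hM hK hKM hgf hfg hi.symm) hκ0
      have h5 := hκ (Γ.select n h) j m
      nlinarith
  choose ρ h0 h1 h2 h3 using key
  refine ⟨ρ, h0, h1, ?_⟩
  set v : Fin M → ℝ := fun j => Real.exp (-(s * (sumLLR f g h m - sumLLR f g h j))) with hv
  have hv0 : ∀ j, 0 ≤ v j := fun j => (Real.exp_pos _).le
  have hvi : ∀ j, v j ≤ v i := fun j => by
    refine Real.exp_le_exp.2 (neg_le_neg (mul_le_mul_of_nonneg_left ?_ hs0))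
    linarith [hML j]
  have himem : i ∈ Finset.univ.erase m := Finset.mem_erase.2 ⟨hi, Finset.mem_univ i⟩
  have hMpos : (0 : ℝ) < M := by
    have : (2 : ℝ) ≤ M := by exact_mod_cast hM
    linarith
  have hpot : potential f g s m h ≤ M * v i := by
    calc potential f g s m h ≤ ∑ _j ∈ Finset.univ.erase m, v i :=
          Finset.sum_le_sum fun j _ => hvi j
      _ ≤ ∑ _j : Fin M, v i :=
          Finset.sum_le_sum_of_subset_of_nonneg (Finset.erase_subset _ _) fun _ _ _ => hv0 i
      _ = M * v i := by simp
  have hδ : 0 ≤ s * (κ * rate f g M K - ε) := mul_nonneg hs0 (sub_nonneg.2 hε)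
  calc ∑ j ∈ Finset.univ.erase m, v j * ρ j
      ≤ ∑ j ∈ Finset.univ.erase m,
        (v j - if j = i then s * (κ * rate f g M K - ε) * v i else 0) := by
        refine Finset.sum_le_sum fun j hj => ?_
        split_ifs with hji
        · subst hji
          nlinarith [mul_le_mul_of_nonneg_left (h3 j rfl) (hv0 j)]
        · nlinarith [mul_le_mul_of_nonneg_left (h2 j (Finset.ne_of_mem_erase hj)) (hv0 j)]
    _ = potential f g s m h - s * (κ * rate f g M K - ε) * v i := by
        rw [Finset.sum_sub_distrib, Finset.sum_ite_eq' _ i, if_pos himem]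
        rfl
    _ ≤ (1 - s * (κ * rate f g M K - ε) / M) * potential f g s m h := by
        have h6 : s * (κ * rate f g M K - ε) / M * potential f g s m h
            ≤ s * (κ * rate f g M K - ε) * v i := by
          rw [div_mul_eq_mul_div, div_le_iff₀ hMpos]
          nlinarith [mul_le_mul_of_nonneg_left hpot hδ]
        nlinarith

end

section

/-! ### The expected time of the Chernoff test -/

variable {M K : ℕ} {Y : Type*} [MeasurableSpace Y] {f g : Measure Y}

lemma le_gap {n : ℕ} {h : Fin n → Step M K Y} {m : Fin M} (hM : 2 ≤ M) {L : ℝ}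
    (hL : ∀ j, j ≠ m → L ≤ sumLLR f g h m - sumLLR f g h j) : L ≤ gap f g h := by
  have : Nontrivial (Fin M) := Fin.nontrivial_iff_two_le.2 hM
  obtain ⟨k, hk⟩ := exists_ne m
  have : Nonempty {j : Fin M // j ≠ m} := ⟨⟨k, hk⟩⟩
  calc L ≤ ⨅ j : {j : Fin M // j ≠ m}, (sumLLR f g h m - sumLLR f g h j) :=
        le_ciInf fun j => hL j j.2
    _ ≤ gap f g h := le_ciSup (f := fun i : Fin M =>
        ⨅ j : {j : Fin M // j ≠ i}, (sumLLR f g h i - sumLLR f g h j))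
        (Set.finite_range _).bddAbove m

lemma exists_le_of_le_gap {n : ℕ} {h : Fin n → Step M K Y} (hM : 2 ≤ M) {L : ℝ}
    (hL : L ≤ gap f g h) : ∃ i, ∀ j, j ≠ i → L ≤ sumLLR f g h i - sumLLR f g h j := by
  have : Nonempty (Fin M) := ⟨⟨0, by omega⟩⟩
  obtain ⟨i, hi⟩ := exists_eq_ciSup_of_finite (f := fun i : Fin M =>
    ⨅ j : {j : Fin M // j ≠ i}, (sumLLR f g h i - sumLLR f g h j))
  refine ⟨i, fun j hj => ?_⟩
  have h1 : L ≤ ⨅ j : {j : Fin M // j ≠ i}, (sumLLR f g h i - sumLLR f g h j) := by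
    rw [hi]; exact hL
  exact h1.trans (ciInf_le (Set.finite_range _).bddBelow (⟨j, hj⟩ : {j : Fin M // j ≠ i}))

variable [IsProbabilityMeasure f] [IsProbabilityMeasure g]

/-- If the potential contracts in expectation after every history, whatever the estimate is, then
it decays exponentially. -/
lemma lintegral_potential_le {s r : ℝ} {Γ : Strategy M K Y} {m : Fin M} (hr : 0 ≤ r)
    (hstep : ∀ (n : ℕ) (h : Fin n → Step M K Y), ∃ ρ : Fin M → ℝ, (∀ j, 0 ≤ ρ j) ∧
      (∀ j, j ≠ m → ∫⁻ t, ENNReal.ofReal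
          (Real.exp (-(s * (stepLLR f g t m - stepLLR f g t j)))) ∂(Γ.stepKernel f g m n h)
          = ENNReal.ofReal (ρ j)) ∧
      ∑ j ∈ Finset.univ.erase m, Real.exp (-(s * (sumLLR f g h m - sumLLR f g h j))) * ρ j
        ≤ r * potential f g s m h) (n : ℕ) :
    ∫⁻ ω, ENNReal.ofReal (potential f g s m (history n ω)) ∂(Γ.law f g m)
      ≤ ENNReal.ofReal (M * r ^ n) := by
  induction n with
  | zero =>
    have h1 : ∀ ω : ℕ → Step M K Y, potential f g s m (history 0 ω) ≤ M * r ^ 0 := by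
      intro ω
      simp only [potential, sumLLR_history_zero]
      simp only [sub_zero, mul_zero, neg_zero, Real.exp_zero, Finset.sum_const, nsmul_eq_mul,
        mul_one, pow_zero]
      exact_mod_cast (Finset.card_le_univ _).trans_eq (Fintype.card_fin M)
    calc _ ≤ ∫⁻ _, ENNReal.ofReal (M * r ^ 0) ∂(Γ.law f g m) :=
          lintegral_mono fun ω => ENNReal.ofReal_le_ofReal (h1 ω)
      _ = _ := by simp
  | succ n ih =>
    have h := lintegral_potential_succ_le Γ m n hr MeasurableSet.univ fun h _ => hstep n h
    simp only [Set.indicator_univ, Pi.one_apply, one_mul] at h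
    refine h.trans ((mul_le_mul_right ih _).trans_eq ?_)
    rw [← ENNReal.ofReal_mul hr]
    congr 1
    ring

/-- The potential is at least `1` when the target does not lead. -/
lemma measure_not_lead_le {s r : ℝ} (hs0 : 0 ≤ s) {Γ : Strategy M K Y} {m : Fin M} {n : ℕ}
    (h : ∫⁻ ω, ENNReal.ofReal (potential f g s m (history n ω)) ∂(Γ.law f g m)
      ≤ ENNReal.ofReal (M * r ^ n)) :
    Γ.law f g m {ω | history n ω ∉ leadSet f g m n} ≤ ENNReal.ofReal (M * r ^ n) := by
  refine le_trans ?_ h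
  have hm : MeasurableSet {ω : ℕ → Step M K Y | history n ω ∉ leadSet f g m n} :=
    measurable_history n (measurableSet_leadSet m n).compl
  rw [← lintegral_indicator_one hm]
  refine lintegral_mono fun ω => ?_
  by_cases hω : history n ω ∈ leadSet f g m n
  · simp [hω]
  · rw [Set.indicator_of_mem (by exact hω), Pi.one_apply, ENNReal.one_le_ofReal]
    simp only [leadSet, Set.mem_ofPred_eq, not_forall, not_lt] at hω
    obtain ⟨j, hj, hle⟩ := hω
    have h1 := exp_le_potential (f := f) (g := g) (L := 0) hs0 hj (h := history n ω) (by linarith)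
    simpa using h1

/-- On the event that the target leads from time `k` on, the potential decays at the rate `a`, at
which it contracts while the target leads. -/
lemma lintegral_potential_stay_le {s r a : ℝ} {Γ : Strategy M K Y} {m : Fin M} (ha : 0 ≤ a)
    (hr : 0 ≤ r) (hr1 : r ≤ 1)
    (hpot : ∀ n, ∫⁻ ω, ENNReal.ofReal (potential f g s m (history n ω)) ∂(Γ.law f g m)
      ≤ ENNReal.ofReal (M * r ^ n))
    (hstep : ∀ (n : ℕ) (h : Fin n → Step M K Y), h ∈ leadSet f g m n →
      ∃ ρ : Fin M → ℝ, (∀ j, 0 ≤ ρ j) ∧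
      (∀ j, j ≠ m → ∫⁻ t, ENNReal.ofReal
          (Real.exp (-(s * (stepLLR f g t m - stepLLR f g t j)))) ∂(Γ.stepKernel f g m n h)
          = ENNReal.ofReal (ρ j)) ∧
      ∑ j ∈ Finset.univ.erase m, Real.exp (-(s * (sumLLR f g h m - sumLLR f g h j))) * ρ j
        ≤ a * potential f g s m h) (k d : ℕ) :
    ∫⁻ ω, (staySet (leadSet f g m) k (k + d)).indicator 1 (history (k + d) ω) *
        ENNReal.ofReal (potential f g s m (history (k + d) ω)) ∂(Γ.law f g m)
      ≤ ENNReal.ofReal (M * a ^ d) := by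
  induction d with
  | zero =>
    have h1 : (M : ℝ) * r ^ k ≤ M * a ^ 0 := by
      rw [pow_zero]
      exact mul_le_mul_of_nonneg_left (pow_le_one₀ hr hr1) (Nat.cast_nonneg M)
    refine le_trans (lintegral_mono fun ω => ?_) ((hpot k).trans (ENNReal.ofReal_le_ofReal h1))
    calc _ ≤ 1 * ENNReal.ofReal (potential f g s m (history k ω)) := by
          refine mul_le_mul_left ?_ _
          exact Set.indicator_le_self' (fun _ _ => zero_le) _
      _ = _ := one_mul _
  | succ d ih =>
    set A : Set (Fin (k + d) → Step M K Y) :=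
      staySet (leadSet f g m) k (k + d) ∩ leadSet f g m (k + d) with hA
    have hAm : MeasurableSet A :=
      (measurableSet_staySet (fun n => measurableSet_leadSet m n) _ _).inter
        (measurableSet_leadSet m _)
    have h1 := lintegral_potential_succ_le Γ m (k + d) ha hAm fun h hh => hstep _ h hh.2
    have h2 : ∀ ω : ℕ → Step M K Y,
        (staySet (leadSet f g m) k (k + (d + 1))).indicator (1 : (Fin (k + (d + 1)) → Step M K Y) → ℝ≥0∞)
          (history (k + (d + 1)) ω) = A.indicator 1 (history (k + d) ω) := by
      intro ω
      have h3 : history (k + (d + 1)) ω ∈ staySet (leadSet f g m) k (k + (d + 1)) ↔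
          history (k + d) ω ∈ A := by
        rw [hA, Set.mem_inter_iff, history_mem_staySet, history_mem_staySet]
        constructor
        · exact fun h => ⟨fun t hk ht => h t hk (by omega), h _ (by omega) (by omega)⟩
        · rintro ⟨h4, h5⟩ t hk ht
          rcases Nat.lt_succ_iff_lt_or_eq.1 (show t < (k + d) + 1 by omega) with h | rfl
          · exact h4 t hk h
          · exact h5
      by_cases h4 : history (k + d) ω ∈ A
      · rw [Set.indicator_of_mem h4, Set.indicator_of_mem (h3.2 h4)]; rfl
      · rw [Set.indicator_of_notMem h4, Set.indicator_of_notMem fun h => h4 (h3.1 h)]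
    simp_rw [h2]
    refine h1.trans ?_
    have h5 : ∫⁻ ω, A.indicator 1 (history (k + d) ω) *
        ENNReal.ofReal (potential f g s m (history (k + d) ω)) ∂(Γ.law f g m)
        ≤ ENNReal.ofReal (M * a ^ d) := by
      refine le_trans (lintegral_mono fun ω => mul_le_mul_left ?_ _) ih
      exact Set.indicator_le_indicator_of_subset Set.inter_subset_left (fun _ => zero_le) _
    refine (mul_le_mul_right h5 _).trans_eq ?_
    rw [← ENNReal.ofReal_mul ha]
    congr 1
    ring

/-- A tail bound for the time of the Chernoff test: either the target does not lead at some time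
after `k`, or it leads from then on and the potential is still large. -/
lemma measure_lt_τ_le {s r a c : ℝ} (hs0 : 0 ≤ s) (hM : 2 ≤ M) {Γ : Strategy M K Y}
    {m : Fin M} (hr : 0 ≤ r) (hr1 : r < 1) (hCT : IsChernoffTest f g c Γ)
    (hpot : ∀ n, ∫⁻ ω, ENNReal.ofReal (potential f g s m (history n ω)) ∂(Γ.law f g m)
      ≤ ENNReal.ofReal (M * r ^ n)) {k d : ℕ}
    (hstay : ∫⁻ ω, (staySet (leadSet f g m) k (k + d)).indicator 1 (history (k + d) ω) *
        ENNReal.ofReal (potential f g s m (history (k + d) ω)) ∂(Γ.law f g m)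
      ≤ ENNReal.ofReal (M * a ^ d)) :
    Γ.law f g m {ω | ((k + d : ℕ) : ℕ∞) < Γ.τ ω}
      ≤ ENNReal.ofReal (M / (1 - r) * r ^ k)
        + ENNReal.ofReal (M * (Real.exp (s * -Real.log c) * a ^ d)) := by
  set L := -Real.log c
  set P := Γ.law f g m
  set A := staySet (leadSet (K := K) f g m) k (k + d)
  have hA : MeasurableSet A := measurableSet_staySet (fun n => measurableSet_leadSet m n) _ _
  have hpm : Measurable fun ω : ℕ → Step M K Y => potential f g s m (history (k + d) ω) :=
    (measurable_potential s m).comp (measurable_history _)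
  set B : Set (ℕ → Step M K Y) := {ω | history (k + d) ω ∈ A ∧
    Real.exp (-(s * L)) ≤ potential f g s m (history (k + d) ω)} with hB
  have hBm : MeasurableSet B := (measurable_history _ hA).inter
    (measurableSet_le measurable_const hpm)
  have hsub : {ω | ((k + d : ℕ) : ℕ∞) < Γ.τ ω} ⊆
      (⋃ i : ℕ, {ω | history (i + k) ω ∉ leadSet f g m (i + k)}) ∪ B := by
    intro ω hω
    by_cases h1 : history (k + d) ω ∈ A
    · right
      refine ⟨h1, ?_⟩
      have h2 := Γ.lt_τ_iff.1 hω (k + d) le_rfl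
      rw [hCT.halt_spec] at h2
      by_contra h3
      refine h2 (le_gap hM (m := m) fun j hj => ?_)
      by_contra h4
      exact h3 (exp_le_potential hs0 hj (not_le.1 h4).le)
    · left
      have h2 : ∃ t, k ≤ t ∧ t < k + d ∧ history t ω ∉ leadSet f g m t := by
        by_contra h3
        push Not at h3
        exact h1 (history_mem_staySet.2 h3)
      obtain ⟨t, hk, -, ht⟩ := h2
      refine Set.mem_iUnion.2 ⟨t - k, ?_⟩
      change history (t - k + k) ω ∉ leadSet f g m (t - k + k)
      rwa [Nat.sub_add_cancel hk]
  have h1 : P (⋃ i : ℕ, {ω | history (i + k) ω ∉ leadSet f g m (i + k)})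
      ≤ ENNReal.ofReal (M / (1 - r) * r ^ k) := by
    refine (measure_iUnion_le _).trans ((ENNReal.tsum_le_tsum fun i =>
      measure_not_lead_le hs0 (hpot (i + k))).trans_eq ?_)
    have h2 : ∀ i : ℕ, (M : ℝ) * r ^ (i + k) = (M * r ^ k) * r ^ i := fun i => by ring
    simp_rw [h2]
    rw [← ENNReal.ofReal_tsum_of_nonneg (fun i => by positivity)
      ((summable_geometric_of_lt_one hr hr1).mul_left _), tsum_mul_left,
      tsum_geometric_of_lt_one hr hr1]
    congr 1
    ring
  have h2 : P B ≤ ENNReal.ofReal (M * (Real.exp (s * L) * a ^ d)) := by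
    have h3 : P B ≤ ∫⁻ ω, ENNReal.ofReal (Real.exp (s * L)) *
        (A.indicator 1 (history (k + d) ω) *
          ENNReal.ofReal (potential f g s m (history (k + d) ω))) ∂P := by
      rw [← lintegral_indicator_one hBm]
      refine lintegral_mono fun ω => ?_
      by_cases hω : ω ∈ B
      · rw [Set.indicator_of_mem hω, Set.indicator_of_mem hω.1, Pi.one_apply, Pi.one_apply, one_mul,
          ← ENNReal.ofReal_mul (Real.exp_pos _).le, ENNReal.one_le_ofReal]
        calc (1 : ℝ) = Real.exp (s * L) * Real.exp (-(s * L)) := by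
              rw [← Real.exp_add, add_neg_cancel, Real.exp_zero]
          _ ≤ _ := mul_le_mul_of_nonneg_left hω.2 (Real.exp_pos _).le
      · rw [Set.indicator_of_notMem hω]
        exact zero_le
    refine h3.trans ?_
    rw [lintegral_const_mul' _ _ ENNReal.ofReal_ne_top]
    refine (mul_le_mul_right hstay _).trans_eq ?_
    rw [← ENNReal.ofReal_mul (Real.exp_pos _).le]
    congr 1
    ring
  exact (measure_mono hsub).trans ((measure_union_le _ _).trans (add_le_add h1 h2))

/-- Summation of tail probabilities: a fixed proportion `1 / p` of the time is used for the first
term of the bound, with `p` so large that the remaining time still gives the rate `β < γ`. -/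
lemma exists_tsum_le_of_tail {r s γ β A B : ℝ} (hr0 : 0 < r) (hr1 : r < 1) (hs0 : 0 < s)
    (hβ0 : 0 < β) (hβγ : β < γ) (hA : 0 ≤ A) (hB : 0 ≤ B) :
    ∃ C : ℝ, 0 ≤ C ∧ ∀ L : ℝ, 0 ≤ L → ∀ u : ℕ → ℝ≥0∞, (∀ n, u n ≤ 1) →
      (∀ k d, u (k + d) ≤ ENNReal.ofReal (A * r ^ k)
        + ENNReal.ofReal (B * Real.exp (s * L - s * (γ * d)))) →
      ∑' n, u n ≤ ENNReal.ofReal (L / β + C) := by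
  have hγ0 : 0 < γ := hβ0.trans hβγ
  obtain ⟨p', hp'⟩ := exists_nat_one_div_lt (K := ℝ)
    (show (0 : ℝ) < 1 - β / γ by rw [sub_pos, div_lt_one hγ0]; exact hβγ)
  obtain ⟨p, hp⟩ : ∃ p, p = p' + 1 := ⟨_, rfl⟩
  have hp0 : (0 : ℝ) < p := by rw [hp]; positivity
  have hpβ : β ≤ γ * (1 - 1 / p) := by
    have h1 : β / γ ≤ 1 - 1 / p := by
      have h2 : (1 : ℝ) / p < 1 - β / γ := by rw [hp]; exact_mod_cast hp'
      linarith
    rw [div_le_iff₀ hγ0] at h1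
    linarith
  obtain ⟨x, hx⟩ : ∃ x, x = (1 - r) / p := ⟨_, rfl⟩
  obtain ⟨r₁, hr₁⟩ : ∃ r₁, r₁ = 1 + -x := ⟨_, rfl⟩
  have hp1 : (1 : ℝ) ≤ p := by rw [hp]; push_cast; linarith [Nat.cast_nonneg (α := ℝ) p']
  have hx1 : x ≤ 1 - r := by rw [hx]; exact div_le_self (by linarith) hp1
  have hx0 : 0 < x := by rw [hx]; exact div_pos (by linarith) hp0
  have hr₁0 : 0 < r₁ := by linarith
  have hr₁1 : r₁ < 1 := by linarith
  -- Bernoulli's inequality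
  have hrp : r ≤ r₁ ^ p := by
    have h1 := one_add_mul_le_pow (a := -x) (by linarith) p
    have h2 : (p : ℝ) * x = 1 - r := by rw [hx, mul_div_cancel₀ _ hp0.ne']
    rw [hr₁]
    linarith
  have hdiv : ∀ n : ℕ, r ^ (n / p) ≤ (r₁ ^ p)⁻¹ * r₁ ^ n := by
    intro n
    have h1 : n ≤ p * (n / p) + p := by
      have h2 := Nat.div_add_mod n p
      have h3 := Nat.mod_lt n (show 0 < p by omega)
      omega
    rw [inv_mul_eq_div, le_div_iff₀ (pow_pos hr₁0 p)]
    calc r ^ (n / p) * r₁ ^ p ≤ (r₁ ^ p) ^ (n / p) * r₁ ^ p :=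
          mul_le_mul_of_nonneg_right (pow_le_pow_left₀ hr0.le hrp _) (pow_pos hr₁0 p).le
      _ = r₁ ^ (p * (n / p) + p) := by rw [← pow_mul, ← pow_add]
      _ ≤ r₁ ^ n := pow_le_pow_of_le_one hr₁0.le hr₁1.le h1
  obtain ⟨q, hq⟩ : ∃ q, q = Real.exp (-(s * β)) := ⟨_, rfl⟩
  have hq1 : q < 1 := by
    rw [hq, Real.exp_lt_one_iff]
    have : 0 < s * β := by positivity
    linarith
  have hq0 : 0 < q := by rw [hq]; exact Real.exp_pos _
  obtain ⟨C₁, hC₁⟩ : ∃ C₁, C₁ = A * (r₁ ^ p)⁻¹ := ⟨_, rfl⟩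
  have hC₁0 : 0 ≤ C₁ := by rw [hC₁]; positivity
  have hr₁' : 0 < 1 - r₁ := by linarith
  have hq' : 0 < 1 - q := by linarith
  refine ⟨1 + (C₁ / (1 - r₁) + B / (1 - q)), by positivity, fun L hL0 u hu1 htail => ?_⟩
  obtain ⟨n₀, hn₀⟩ : ∃ n₀, n₀ = ⌈L / β⌉₊ := ⟨_, rfl⟩
  have hn₀L : L ≤ β * n₀ := by
    have := Nat.le_ceil (L / β)
    rw [div_le_iff₀ hβ0, ← hn₀] at this
    linarith
  have htail' : ∀ i : ℕ, u (i + n₀) ≤ ENNReal.ofReal (C₁ * r₁ ^ i + B * q ^ i) := by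
    intro i
    obtain ⟨n, hn⟩ : ∃ n, n = i + n₀ := ⟨_, rfl⟩
    rw [← hn]
    have hkd : n / p + (n - n / p) = n := Nat.add_sub_cancel' (Nat.div_le_self n p)
    have h1 := htail (n / p) (n - n / p)
    rw [hkd] at h1
    rw [ENNReal.ofReal_add (by positivity) (by positivity)]
    refine h1.trans (add_le_add (ENNReal.ofReal_le_ofReal ?_) (ENNReal.ofReal_le_ofReal ?_))
    · calc A * r ^ (n / p) ≤ A * ((r₁ ^ p)⁻¹ * r₁ ^ n) :=
            mul_le_mul_of_nonneg_left (hdiv n) hA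
        _ = C₁ * r₁ ^ n := by rw [hC₁, mul_assoc]
        _ ≤ C₁ * r₁ ^ i := mul_le_mul_of_nonneg_left
            (pow_le_pow_of_le_one hr₁0.le hr₁1.le (by omega)) hC₁0
    · refine mul_le_mul_of_nonneg_left ?_ hB
      obtain ⟨d, hd⟩ : ∃ d, d = n - n / p := ⟨_, rfl⟩
      rw [← hd]
      have hd1 : (n : ℝ) * (1 - 1 / p) ≤ d := by
        rw [hd, Nat.cast_sub (Nat.div_le_self n p)]
        have h2 : ((n / p : ℕ) : ℝ) ≤ n / p := Nat.cast_div_le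
        have h3 : (n : ℝ) * (1 - 1 / p) = n - n / p := by ring
        linarith
      calc Real.exp (s * L - s * (γ * d)) ≤ Real.exp (i * -(s * β)) := by
            refine Real.exp_le_exp.2 ?_
            have h4 : β * n ≤ γ * d := by
              calc β * n ≤ γ * (1 - 1 / p) * n :=
                    mul_le_mul_of_nonneg_right hpβ (Nat.cast_nonneg n)
                _ = γ * (n * (1 - 1 / p)) := by ring
                _ ≤ γ * d := mul_le_mul_of_nonneg_left hd1 hγ0.le
            have h5 : β * n = β * i + β * n₀ := by rw [hn]; push_cast; ring
            have h6 : L - γ * d ≤ -(β * i) := by linarith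
            have h7 := mul_le_mul_of_nonneg_left h6 hs0.le
            linarith
        _ = q ^ i := by rw [hq, ← Real.exp_nat_mul]
  rw [← Summable.sum_add_tsum_nat_add' (f := u) (k := n₀) ENNReal.summable]
  have hfirst : ∑ n ∈ Finset.range n₀, u n ≤ (n₀ : ℝ≥0∞) := by
    calc _ ≤ ∑ _n ∈ Finset.range n₀, (1 : ℝ≥0∞) := Finset.sum_le_sum fun n _ => hu1 n
      _ = n₀ := by simp
  have hsecond : ∑' i : ℕ, u (i + n₀) ≤ ENNReal.ofReal (C₁ / (1 - r₁) + B / (1 - q)) := by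
    refine (ENNReal.tsum_le_tsum htail').trans_eq ?_
    have hs1 := (summable_geometric_of_lt_one hr₁0.le hr₁1).mul_left C₁
    have hs2 := (summable_geometric_of_lt_one hq0.le hq1).mul_left B
    rw [← ENNReal.ofReal_tsum_of_nonneg (fun i => by positivity) (hs1.add hs2),
      hs1.tsum_add hs2, tsum_mul_left, tsum_mul_left, tsum_geometric_of_lt_one hr₁0.le hr₁1,
      tsum_geometric_of_lt_one hq0.le hq1]
    rfl
  refine (add_le_add hfirst hsecond).trans ?_
  rw [← ENNReal.ofReal_natCast, ← ENNReal.ofReal_add (Nat.cast_nonneg _) (by positivity)]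
  refine ENNReal.ofReal_le_ofReal ?_
  have hn₀' : (n₀ : ℝ) ≤ L / β + 1 := by
    rw [hn₀]
    exact (Nat.ceil_lt_add_one (by positivity)).le
  linarith

/-- Every rate `β` below `I*` is attained by the Chernoff test up to an additive constant that does
not depend on the cost. -/
lemma exists_expectedTime_le (hM : 2 ≤ M) (hK : 1 ≤ K) (hKM : K ≤ M) (hne : f ≠ g)
    (hgf : klDiv g f ≠ ∞) (hfg : klDiv f g ≠ ∞) {β : ℝ} (hβ0 : 0 < β)
    (hβ : β < rate f g M K) :
    ∃ C : ℝ, 0 ≤ C ∧ ∀ c : ℝ, 0 < c → c < 1 → ∀ Γ : Strategy M K Y, IsChernoffTest f g c Γ →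
      ∀ m, Γ.expectedTime f g m ≤ ENNReal.ofReal (-Real.log c / β + C) := by
  have hD1 := toReal_klDiv_pos hne.symm hgf
  have hD2 := toReal_klDiv_pos hne hfg
  obtain ⟨κ, hκ0, hκ1, hκ⟩ := exists_meanDiv_swap (M := M) (K := K) hD1 hD2
  set I := rate f g M K with hI
  have hI0 : 0 < I := hβ0.trans hβ
  have hM2 : (2 : ℝ) ≤ M := by exact_mod_cast hM
  set ε := min ((I - β) / 2) (κ * I / 2) with hεdef
  have hε0 : 0 < ε := lt_min (by linarith) (by positivity)
  have hε1 : ε ≤ (I - β) / 2 := min_le_left _ _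
  have hε2 : ε ≤ κ * I / 2 := min_le_right _ _
  have hκI : κ * I ≤ I := by nlinarith
  set δ := κ * I - ε with hδ
  have hδ0 : 0 < δ := by
    have : 0 < κ * I := by positivity
    linarith
  have hIε : β < I - ε := by linarith
  have hsmall : ∀ᶠ s in 𝓝[>] (0 : ℝ), s ∈ Set.Ioc (0 : ℝ) (1 / I) :=
    Ioc_mem_nhdsGT (by positivity)
  obtain ⟨s, hs, hs0, hsI⟩ :=
    ((eventually_goodExponent (M := M) (K := K) hgf hfg hε0).and hsmall).exists
  have hsI' : s * I ≤ 1 := by rwa [le_div_iff₀ hI0] at hsI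
  set a := 1 - s * (I - ε) with ha
  have ha0 : 0 ≤ a := by
    have : s * (I - ε) ≤ s * I := mul_le_mul_of_nonneg_left (by linarith) hs0.le
    linarith
  set r := 1 - s * δ / M with hr
  have hM0 : (0 : ℝ) < M := by linarith
  have hsδ : s * δ / M ≤ 1 / 2 := by
    rw [div_le_iff₀ hM0]
    have : s * δ ≤ s * I := mul_le_mul_of_nonneg_left (by linarith) hs0.le
    linarith
  have hr0 : 0 < r := by linarith
  have hr1 : r < 1 := by
    have : 0 < s * δ / M := by positivity
    linarith
  have har : a ≤ r := by
    have h1 : s * δ / M ≤ s * δ := div_le_self (by positivity) (by linarith)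
    have h2 : s * δ ≤ s * (I - ε) := mul_le_mul_of_nonneg_left (by linarith) hs0.le
    linarith
  have h1r : 0 < 1 - r := by linarith
  obtain ⟨C, hC0, hC⟩ := exists_tsum_le_of_tail (A := M / (1 - r)) (B := M) hr0 hr1 hs0 hβ0 hIε
    (by positivity) hM0.le
  refine ⟨C, hC0, fun c hc0 hc1 Γ hCT m => ?_⟩
  set L := -Real.log c with hL
  have hL0 : 0 ≤ L := by
    have := Real.log_neg hc0 hc1
    linarith
  have hstep : ∀ (n : ℕ) (h : Fin n → Step M K Y), ∃ ρ : Fin M → ℝ, (∀ j, 0 ≤ ρ j) ∧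
      (∀ j, j ≠ m → ∫⁻ t, ENNReal.ofReal
          (Real.exp (-(s * (stepLLR f g t m - stepLLR f g t j)))) ∂(Γ.stepKernel f g m n h)
          = ENNReal.ofReal (ρ j)) ∧
      ∑ j ∈ Finset.univ.erase m, Real.exp (-(s * (sumLLR f g h m - sumLLR f g h j))) * ρ j
        ≤ r * potential f g s m h := by
    intro n h
    obtain ⟨i, hML, hd⟩ := hCT.select_spec n h
    by_cases hi : i = m
    · subst hi
      obtain ⟨ρ, h0, h1, h2⟩ := hs.lead_step hs0.le hM hK hKM hgf hfg hd
      exact ⟨ρ, h0, h1, h2.trans (mul_le_mul_of_nonneg_right har (potential_nonneg s i h))⟩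
    · exact hs.wrong_step hs0.le hM hK hKM hgf hfg hκ0.le (by linarith) hκ hi hML hd
  have hlead : ∀ (n : ℕ) (h : Fin n → Step M K Y), h ∈ leadSet f g m n →
      ∃ ρ : Fin M → ℝ, (∀ j, 0 ≤ ρ j) ∧
      (∀ j, j ≠ m → ∫⁻ t, ENNReal.ofReal
          (Real.exp (-(s * (stepLLR f g t m - stepLLR f g t j)))) ∂(Γ.stepKernel f g m n h)
          = ENNReal.ofReal (ρ j)) ∧
      ∑ j ∈ Finset.univ.erase m, Real.exp (-(s * (sumLLR f g h m - sumLLR f g h j))) * ρ j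
        ≤ a * potential f g s m h := by
    intro n h hh
    obtain ⟨i, hML, hd⟩ := hCT.select_spec n h
    have hi : i = m := by
      by_contra hi
      exact absurd (hh i hi) (not_lt.2 (hML m))
    subst hi
    exact hs.lead_step hs0.le hM hK hKM hgf hfg hd
  have hpot := lintegral_potential_le hr0.le hstep
  rw [Strategy.expectedTime_eq_tsum]
  refine hC L hL0 _ (fun n => prob_le_one) fun k d => ?_
  refine (measure_lt_τ_le hs0.le hM hr0.le hr1 hCT hpot
    (lintegral_potential_stay_le ha0 hr0.le hr1.le hpot hlead k d)).trans
    (add_le_add le_rfl (ENNReal.ofReal_le_ofReal (mul_le_mul_of_nonneg_left ?_ hM0.le)))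
  have ha1 : a ≤ Real.exp (-(s * (I - ε))) := by
    have := Real.add_one_le_exp (-(s * (I - ε)))
    linarith
  calc Real.exp (s * L) * a ^ d
      ≤ Real.exp (s * L) * Real.exp (-(s * (I - ε))) ^ d :=
        mul_le_mul_of_nonneg_left (pow_le_pow_left₀ ha0 ha1 d) (Real.exp_pos _).le
    _ = Real.exp (s * L - s * ((I - ε) * d)) := by
        rw [← Real.exp_nat_mul, ← Real.exp_add]
        congr 1; ring

end

section

variable {M K : ℕ} {Y : Type*} [MeasurableSpace Y] {f g : Measure Y}

/-! ### Existence of the Chernoff test -/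

lemma measurableSet_isMLEstimate (n : ℕ) (i : Fin M) :
    MeasurableSet {h : Fin n → Step M K Y | IsMLEstimate f g h i} := by
  have h : {h : Fin n → Step M K Y | IsMLEstimate f g h i}
      = ⋂ j : Fin M, {h | sumLLR f g h j ≤ sumLLR f g h i} := by
    ext h; simp [IsMLEstimate]
  rw [h]
  exact MeasurableSet.iInter fun j => measurableSet_le (measurable_sumLLR j) (measurable_sumLLR i)

lemma exists_measurable_isMLEstimate (hM : 2 ≤ M) (n : ℕ) :
    ∃ e : (Fin n → Step M K Y) → Fin M, Measurable e ∧ ∀ h, IsMLEstimate f g h (e h) := by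
  classical
  have : Nonempty (Fin M) := ⟨⟨0, by omega⟩⟩
  have hne : ∀ h : Fin n → Step M K Y,
      (Finset.univ.filter fun i => IsMLEstimate f g h i).Nonempty := by
    intro h
    obtain ⟨i, hi⟩ := Finite.exists_max fun j => sumLLR f g h j
    exact ⟨i, Finset.mem_filter.2 ⟨Finset.mem_univ i, hi⟩⟩
  refine ⟨fun h => (Finset.univ.filter fun i => IsMLEstimate f g h i).min' (hne h),
    measurable_to_countable' fun i => ?_, fun h => by
      simpa using Finset.min'_mem _ (hne h)⟩
  have h : (fun h : Fin n → Step M K Y =>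
      (Finset.univ.filter fun i => IsMLEstimate f g h i).min' (hne h)) ⁻¹' {i}
      = {h | IsMLEstimate f g h i} ∩ ⋂ (k : Fin M) (_ : k < i), {h | IsMLEstimate f g h k}ᶜ := by
    ext h
    simp only [Set.mem_preimage, Set.mem_singleton_iff, Set.mem_inter_iff, Set.mem_ofPred_eq,
      Set.mem_iInter, Set.mem_compl_iff]
    constructor
    · rintro rfl
      refine ⟨by simpa using Finset.min'_mem _ (hne h), fun k hk hk' => ?_⟩
      exact absurd (Finset.min'_le _ k (by simpa using hk')) (not_le.2 hk)
    · rintro ⟨h1, h2⟩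
      refine le_antisymm (Finset.min'_le _ i (by simpa using h1)) ?_
      refine Finset.le_min' _ _ _ fun k hk => ?_
      by_contra h3
      exact h2 k (not_le.1 h3) (by simpa using hk)
  rw [h]
  exact (measurableSet_isMLEstimate n i).inter (MeasurableSet.iInter fun k =>
    MeasurableSet.iInter fun _ => (measurableSet_isMLEstimate n k).compl)

lemma measurable_gap (n : ℕ) :
    Measurable fun h : Fin n → Step M K Y => gap f g h := by
  unfold gap
  exact Measurable.iSup fun i => Measurable.iInf fun j =>
    (measurable_sumLLR i).sub (measurable_sumLLR _)

/-- A cell leading by a positive margin is the only maximum likelihood estimate. -/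
lemma IsMLEstimate.le_sub {n : ℕ} {h : Fin n → Step M K Y} (hM : 2 ≤ M) {i : Fin M}
    (hi : IsMLEstimate f g h i) {L : ℝ} (hL0 : 0 < L) (hL : L ≤ gap f g h) {j : Fin M}
    (hj : j ≠ i) : L ≤ sumLLR f g h i - sumLLR f g h j := by
  obtain ⟨k, hk⟩ := exists_le_of_le_gap hM hL
  have hki : k = i := by
    by_contra hne
    have h1 := hk i (Ne.symm hne)
    have h2 := hi k
    linarith
  subst hki
  exact hk j hj

variable [IsProbabilityMeasure f] [IsProbabilityMeasure g]

lemma exists_isChernoffTest (hM : 2 ≤ M) (hK : 1 ≤ K) (hKM : K ≤ M)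
    (hgf : klDiv g f ≠ ∞) (hfg : klDiv f g ≠ ∞) (c : ℝ) :
    ∃ Γ : Strategy M K Y, IsChernoffTest f g c Γ := by
  choose q hq hqd using exists_isChernoffDesign (f := f) (g := g) hM hK hKM hgf hfg
  choose e he hmle using exists_measurable_isMLEstimate (K := K) (f := f) (g := g) hM
  exact ⟨{
    select := fun n => (Kernel.ofFunOfCountable q).comap (e n) (he n)
    select_markov := fun n => ⟨fun h => hq (e n h)⟩
    halt := fun n => {h | -Real.log c ≤ gap f g h}
    measurableSet_halt := fun n => measurableSet_le measurable_const (measurable_gap n)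
    decide := e
    measurable_decide := he }, {
    select_spec := fun n h => ⟨e n h, hmle n h, hqd (e n h)⟩
    halt_spec := fun n h => Iff.rfl
    decide_spec := fun n h _ => hmle n h }⟩

/-! ### The error probability of the Chernoff test -/

lemma law_history_preimage (Γ : Strategy M K Y) (m : Fin M) (n : ℕ)
    {A : Set (Fin n → Step M K Y)} (hA : MeasurableSet A) :
    Γ.law f g m (history n ⁻¹' A) = ∫⁻ ω, A.indicator 1 (history n ω) ∂(Γ.law f g m) := by
  rw [← lintegral_indicator_one (measurable_history n hA)]
  rfl

/-- A wrong cell `i` is declared only when the likelihood ratio of `H_m` against `H_i` is at most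
`c`; so a change of measure bounds the probability of this error. -/
lemma IsChernoffTest.law_declares_le {c : ℝ} (hc0 : 0 < c) (hc1 : c < 1) (hM : 2 ≤ M)
    (hgf : g ≪ f) (hfg : f ≪ g) {Γ : Strategy M K Y} (hCT : IsChernoffTest f g c Γ)
    {m i : Fin M} (hi : i ≠ m) : Γ.law f g m (Γ.declares i) ≤ ENNReal.ofReal c := by
  have hA := Γ.measurableSet_declareSet i
  have key : ∀ n, Γ.law f g m (history n ⁻¹' Γ.declareSet i n)
      ≤ ENNReal.ofReal c * Γ.law f g i (history n ⁻¹' Γ.declareSet i n) := by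
    intro n
    rw [law_history_preimage Γ m n (hA n), law_history_preimage Γ i n (hA n),
      lintegral_history_change Γ i hgf hfg m n (measurable_one.indicator (hA n)),
      ← lintegral_const_mul' _ _ ENNReal.ofReal_ne_top]
    refine lintegral_mono fun ω => ?_
    by_cases hω : history n ω ∈ Γ.declareSet i n
    · rw [Set.indicator_of_mem hω, Pi.one_apply, one_mul, mul_one]
      refine ENNReal.ofReal_le_ofReal ?_
      have h1 : history n ω ∈ Γ.halt n := hω.1.1
      have h2 := hCT.decide_spec n _ h1
      have h3 : Γ.decide n (history n ω) = i := hω.2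
      rw [h3] at h2
      have h4 := h2.le_sub hM (L := -Real.log c) (by linarith [Real.log_neg hc0 hc1])
        ((hCT.halt_spec n _).1 h1) hi.symm
      calc Real.exp (sumLLR f g (history n ω) m - sumLLR f g (history n ω) i)
          ≤ Real.exp (Real.log c) := Real.exp_le_exp.2 (by linarith)
        _ = c := Real.exp_log hc0
    · simp [Set.indicator_of_notMem hω]
  have hm : ∀ n, MeasurableSet (history n ⁻¹' Γ.declareSet i n) :=
    fun n => measurable_history n (hA n)
  rw [Γ.declares_eq_iUnion i, measure_iUnion (Γ.disjoint_declareSet i) hm]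
  calc ∑' n, Γ.law f g m (history n ⁻¹' Γ.declareSet i n)
      ≤ ∑' n, ENNReal.ofReal c * Γ.law f g i (history n ⁻¹' Γ.declareSet i n) :=
        ENNReal.tsum_le_tsum key
    _ = ENNReal.ofReal c * Γ.law f g i (⋃ n, history n ⁻¹' Γ.declareSet i n) := by
        rw [ENNReal.tsum_mul_left, measure_iUnion (Γ.disjoint_declareSet i) hm]
    _ ≤ ENNReal.ofReal c * 1 := mul_le_mul_right prob_le_one _
    _ = ENNReal.ofReal c := mul_one _

lemma IsChernoffTest.errorProb_le {c : ℝ} (hc0 : 0 < c) (hc1 : c < 1) (hM : 2 ≤ M)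
    (hgf : g ≪ f) (hfg : f ≪ g) {Γ : Strategy M K Y} (hCT : IsChernoffTest f g c Γ)
    {m : Fin M} (hτ : Γ.expectedTime f g m ≠ ∞) :
    Γ.errorProb f g m ≤ ENNReal.ofReal (M * c) := by
  have hsub : (Γ.declares m)ᶜ ⊆ {ω | Γ.τ ω = ⊤} ∪ ⋃ i ∈ Finset.univ.erase m, Γ.declares i := by
    intro ω hω
    rcases eq_or_ne (Γ.τ ω) ⊤ with h | h
    · exact Or.inl h
    · right
      obtain ⟨n, hn⟩ := ENat.ne_top_iff_exists.1 h
      have hne : Γ.decide n (history n ω) ≠ m := fun h1 => hω ⟨n, hn.symm, h1⟩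
      exact Set.mem_biUnion (x := Γ.decide n (history n ω))
        (Finset.mem_coe.2 (Finset.mem_erase.2 ⟨hne, Finset.mem_univ _⟩)) ⟨n, hn.symm, rfl⟩
  calc Γ.errorProb f g m
      ≤ Γ.law f g m {ω | Γ.τ ω = ⊤}
        + Γ.law f g m (⋃ i ∈ Finset.univ.erase m, Γ.declares i) :=
        (measure_mono hsub).trans (measure_union_le _ _)
    _ ≤ 0 + ∑ i ∈ Finset.univ.erase m, Γ.law f g m (Γ.declares i) :=
        add_le_add (Γ.measure_τ_eq_top f g m hτ).le (measure_biUnion_finset_le _ _)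
    _ ≤ ∑ _i ∈ Finset.univ.erase m, ENNReal.ofReal c := by
        rw [zero_add]
        exact Finset.sum_le_sum fun i hi =>
          hCT.law_declares_le hc0 hc1 hM hgf hfg (Finset.ne_of_mem_erase hi)
    _ ≤ ∑ _i : Fin M, ENNReal.ofReal c :=
        Finset.sum_le_sum_of_subset (Finset.erase_subset _ _)
    _ = ENNReal.ofReal (M * c) := by
        rw [Finset.sum_const, Finset.card_univ, Fintype.card_fin, nsmul_eq_mul,
          ENNReal.ofReal_mul (Nat.cast_nonneg _), ENNReal.ofReal_natCast]

end

section

/-! ### The information bound for arbitrary strategies -/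

variable {M K : ℕ} {Y : Type*} [MeasurableSpace Y] {f g : Measure Y}

lemma sumLLR_history_eq_sum (n : ℕ) (ω : ℕ → Step M K Y) (j : Fin M) :
    sumLLR f g (history n ω) j = ∑ t ∈ Finset.range n, stepLLR f g (ω t) j := by
  rw [Finset.sum_range]
  rfl

/-- The difference `S_m - S_j` at the time `min τ n`. -/
noncomputable def stoppedLLR (Γ : Strategy M K Y) (f g : Measure Y) (m j : Fin M) (n : ℕ)
    (ω : ℕ → Step M K Y) : ℝ :=
  ∑ t ∈ Finset.range n,
    if (t : ℕ∞) < Γ.τ ω then stepLLR f g (ω t) m - stepLLR f g (ω t) j else 0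

/-- With `k = min τ n`, the stopped difference is the one of the history of length `k`. -/
lemma stoppedLLR_of_eq {Γ : Strategy M K Y} {m j : Fin M} {n k : ℕ} {ω : ℕ → Step M K Y}
    (hk : k ≤ n) (hτ : Γ.τ ω = k ∨ (k = n ∧ (n : ℕ∞) ≤ Γ.τ ω)) :
    stoppedLLR Γ f g m j n ω = sumLLR f g (history k ω) m - sumLLR f g (history k ω) j := by
  rw [sumLLR_history_eq_sum, sumLLR_history_eq_sum, ← Finset.sum_sub_distrib, stoppedLLR]
  have h1 : ∀ t ∈ Finset.range n, ((t : ℕ∞) < Γ.τ ω ↔ t < k) := by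
    intro t ht
    rcases hτ with h | ⟨rfl, h⟩
    · rw [h]; exact Nat.cast_lt
    · have h2 := Finset.mem_range.1 ht
      exact ⟨fun _ => h2, fun _ => lt_of_lt_of_le (Nat.cast_lt.2 h2) h⟩
  rw [Finset.sum_congr rfl fun t ht => if_congr (h1 t ht) rfl rfl, ← Finset.sum_filter]
  refine Finset.sum_congr ?_ fun _ _ => rfl
  ext t
  simp only [Finset.mem_filter, Finset.mem_range]
  omega

lemma measurable_stoppedLLR (Γ : Strategy M K Y) (m j : Fin M) (n : ℕ) :
    Measurable (stoppedLLR Γ f g m j n) := by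
  refine Finset.measurable_sum _ fun t _ => Measurable.ite (Γ.measurableSet_lt_τ t) ?_
    measurable_const
  exact ((measurable_stepLLR m).comp (measurable_pi_apply t)).sub
    ((measurable_stepLLR j).comp (measurable_pi_apply t))

variable [IsProbabilityMeasure f] [IsProbabilityMeasure g]

/-- A function of one step whose conditional mean given any selection is at most `D` has mean at
most `D P(B)` on every event `B` of the past. -/
lemma integral_step_le (Γ : Strategy M K Y) (m : Fin M) (n : ℕ) {x : Step M K Y → ℝ}
    (hx : Measurable x) (hint : ∀ u, Integrable (fun y => x (u, y)) (obsLaw f g m u)) {D : ℝ}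
    (hD : ∀ u, ∫ y, x (u, y) ∂(obsLaw f g m u) ≤ D) {B : Set (Fin n → Step M K Y)}
    (hB : MeasurableSet B) :
    Integrable (fun ω => B.indicator 1 (history n ω) * x (ω n)) (Γ.law f g m) ∧
    ∫ ω, B.indicator 1 (history n ω) * x (ω n) ∂(Γ.law f g m)
      ≤ D * (Γ.law f g m).real (history n ⁻¹' B) := by
  set P := Γ.law f g m
  set κ := Γ.stepKernel f g m n
  have hsel : ∀ h u, Γ.select n h {u} ≤ 1 := fun h u => prob_le_one
  have hκfin : ∀ h, ∫⁻ t, ‖x t‖ₑ ∂(κ h) ≤ ∑ u, ∫⁻ y, ‖x (u, y)‖ₑ ∂(obsLaw f g m u) := by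
    intro h
    rw [lintegral_stepKernel _ _ _ _ _ _ hx.enorm]
    exact Finset.sum_le_sum fun u _ => mul_le_of_le_one_right' (hsel h u)
  have hCfin : ∑ u, ∫⁻ y, ‖x (u, y)‖ₑ ∂(obsLaw f g m u) < ∞ :=
    ENNReal.sum_lt_top.2 fun u _ => (hint u).2
  have hκint : ∀ h, Integrable x (κ h) := fun h =>
    ⟨hx.aestronglyMeasurable, (hκfin h).trans_lt hCfin⟩
  have hκmean : ∀ h, ∫ t, x t ∂(κ h) ≤ D := by
    intro h
    have h1 : ∫ t, x t ∂(κ h)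
        = ∫ u, ∫ y, x (u, y) ∂(obsLaw f g m u) ∂(Γ.select n h) := by
      have h2 := hκint h
      simp only [κ, Strategy.stepKernel] at h2 ⊢
      rw [ProbabilityTheory.integral_compProd h2]
      rfl
    rw [h1]
    have hfi : Integrable (fun u => ∫ y, x (u, y) ∂(obsLaw f g m u)) (Γ.select n h) :=
      Integrable.of_finite
    calc _ ≤ ∫ _, D ∂(Γ.select n h) := integral_mono hfi (integrable_const D) hD
      _ = D := by simp
  have hind : Measurable (B.indicator (1 : (Fin n → Step M K Y) → ℝ)) :=
    measurable_one.indicator hB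
  have hindle : ∀ h, ‖B.indicator (1 : (Fin n → Step M K Y) → ℝ) h‖ₑ ≤ 1 := by
    intro h
    by_cases hh : h ∈ B <;> simp [hh]
  set H : (Fin n → Step M K Y) × Step M K Y → ℝ := fun p => B.indicator 1 p.1 * x p.2 with hHdef
  have hHm : Measurable H := (hind.comp measurable_fst).mul (hx.comp measurable_snd)
  have hpair : Measurable fun ω : ℕ → Step M K Y => (history n ω, ω n) := by fun_prop
  have hHint : Integrable (fun ω => H (history n ω, ω n)) P := by
    refine ⟨(hHm.comp hpair).aestronglyMeasurable, ?_⟩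
    have h1 : ∫⁻ ω, ‖H (history n ω, ω n)‖ₑ ∂P ≤ ∫⁻ ω, ‖x (ω n)‖ₑ ∂P := by
      refine lintegral_mono fun ω => ?_
      rw [hHdef, enorm_mul]
      exact mul_le_of_le_one_left' (hindle _)
    have h2 := lintegral_history_step Γ f g m n (H := fun p => ‖x p.2‖ₑ)
      (hx.enorm.comp measurable_snd)
    have h3 : ∫⁻ ω, ‖x (ω n)‖ₑ ∂P ≤ ∑ u, ∫⁻ y, ‖x (u, y)‖ₑ ∂(obsLaw f g m u) := by
      refine h2.trans_le ((lintegral_mono fun ω => hκfin (history n ω)).trans_eq ?_)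
      rw [lintegral_const, measure_univ, mul_one]
    exact (h1.trans h3).trans_lt hCfin
  refine ⟨hHint, ?_⟩
  have hHint' : Integrable H (P.map (history n) ⊗ₘ κ) := by
    rw [← map_law_history_step]
    exact (integrable_map_measure hHm.aestronglyMeasurable hpair.aemeasurable).2 hHint
  have h1 : ∫ ω, H (history n ω, ω n) ∂P = ∫ h, ∫ t, H (h, t) ∂(κ h) ∂(P.map (history n)) := by
    rw [← Measure.integral_compProd hHint', ← map_law_history_step,
      integral_map hpair.aemeasurable hHm.aestronglyMeasurable]
  have hPm : IsProbabilityMeasure (P.map (history n)) :=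
    Measure.isProbabilityMeasure_map (measurable_history n).aemeasurable
  calc ∫ ω, H (history n ω, ω n) ∂P = ∫ h, ∫ t, H (h, t) ∂(κ h) ∂(P.map (history n)) := h1
    _ ≤ ∫ h, D * B.indicator 1 h ∂(P.map (history n)) := by
        refine integral_mono hHint'.integral_compProd
          (((integrable_const (1 : ℝ)).indicator hB).const_mul D) fun h => ?_
        by_cases hh : h ∈ B
        · simp only [hHdef, Set.indicator_of_mem hh, Pi.one_apply, one_mul, mul_one]
          exact hκmean h
        · simp [hHdef, Set.indicator_of_notMem hh]
    _ = D * P.real (history n ⁻¹' B) := by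
        rw [integral_const_mul, integral_indicator_one hB,
          map_measureReal_apply (measurable_history n) hB]

end

section

variable {M K : ℕ} {Y : Type*} [MeasurableSpace Y] {f g : Measure Y}

lemma history_mem_staySet_halt {Γ : Strategy M K Y} {n : ℕ} {ω : ℕ → Step M K Y} :
    history n ω ∈ staySet (fun k => (Γ.halt k)ᶜ) 0 n ↔ (n : ℕ∞) ≤ Γ.τ ω := by
  rw [history_mem_staySet]
  constructor
  · intro h
    refine le_iInf₂ fun k hk => ?_
    by_contra hkn
    exact h k (Nat.zero_le k) (by exact_mod_cast not_le.1 hkn) hk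
  · intro h t _ ht
    exact Γ.lt_τ_iff.1 (lt_of_lt_of_le (Nat.cast_lt.2 ht) h) t le_rfl

/-- The event that the search stops before the time `n` and declares the cell `m`. -/
def declaresBefore (Γ : Strategy M K Y) (m : Fin M) (n : ℕ) : Set (ℕ → Step M K Y) :=
  {ω | ∃ t < n, Γ.τ ω = t ∧ Γ.decide t (history t ω) = m}

lemma measurableSet_declaresBefore (Γ : Strategy M K Y) (m : Fin M) (n : ℕ) :
    MeasurableSet (declaresBefore Γ m n) := by
  have h : declaresBefore Γ m n = ⋃ (t : ℕ) (_ : t < n), history t ⁻¹' Γ.declareSet m t := by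
    ext ω
    simp only [declaresBefore, Set.mem_ofPred_eq, Set.mem_iUnion, Set.mem_preimage,
      Strategy.declareSet, Set.mem_inter_iff, Strategy.history_mem_stopSet, Set.mem_singleton_iff,
      exists_prop]
  rw [h]
  exact MeasurableSet.iUnion fun t => MeasurableSet.iUnion fun _ =>
    measurable_history t (Γ.measurableSet_declareSet m t)

lemma tendsto_measure_declaresBefore (Γ : Strategy M K Y) (m : Fin M)
    (μ : Measure (ℕ → Step M K Y)) :
    Tendsto (fun n => μ (declaresBefore Γ m n)) atTop (𝓝 (μ (Γ.declares m))) := by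
  have h : Γ.declares m = ⋃ n, declaresBefore Γ m n := by
    ext ω
    simp only [Strategy.declares, declaresBefore, Set.mem_ofPred_eq, Set.mem_iUnion]
    constructor
    · rintro ⟨t, ht⟩
      exact ⟨t + 1, t, Nat.lt_succ_self t, ht⟩
    · rintro ⟨n, t, -, ht⟩
      exact ⟨t, ht⟩
  rw [h]
  refine tendsto_measure_iUnion_atTop fun n k hnk ω => ?_
  rintro ⟨t, ht, h⟩
  exact ⟨t, ht.trans_le hnk, h⟩

variable [IsProbabilityMeasure f] [IsProbabilityMeasure g]

/-- Change of measure at the time `min τ n`, with an additional weight `e^b` on the event that the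
cell `m` is declared. -/
lemma lintegral_exp_stoppedLLR_le (hgf : g ≪ f) (hfg : f ≪ g) (Γ : Strategy M K Y)
    (m j : Fin M) (n : ℕ) (b : ℝ) :
    ∫⁻ ω, ENNReal.ofReal (Real.exp ((declaresBefore Γ m n).indicator (fun _ => b) ω
        - stoppedLLR Γ f g m j n ω)) ∂(Γ.law f g m)
      ≤ 1 + ENNReal.ofReal (Real.exp b) * Γ.law f g j (Γ.declares m) := by
  classical
  set F : ∀ t : ℕ, (Fin t → Step M K Y) → ℝ≥0∞ := fun t =>
    (Γ.stopSet t).indicator fun h => if Γ.decide t h = m then ENNReal.ofReal (Real.exp b) else 1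
    with hF
  have hFm : ∀ t, Measurable (F t) := fun t =>
    (Measurable.ite (Γ.measurable_decide t (MeasurableSet.singleton m)) measurable_const
      measurable_const).indicator (Γ.measurableSet_stopSet t)
  set S : Set (Fin n → Step M K Y) := staySet (fun k => (Γ.halt k)ᶜ) 0 n with hS
  have hSm : MeasurableSet S := measurableSet_staySet (fun k => (Γ.measurableSet_halt k).compl) 0 n
  have hSm' : Measurable (S.indicator (1 : (Fin n → Step M K Y) → ℝ≥0∞)) :=
    measurable_one.indicator hSm
  have hE : ∀ t, Measurable fun ω : ℕ → Step M K Y => ENNReal.ofReal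
      (Real.exp (sumLLR f g (history t ω) j - sumLLR f g (history t ω) m)) := fun t =>
    ENNReal.measurable_ofReal.comp (Real.measurable_exp.comp
      (((measurable_sumLLR j).comp (measurable_history t)).sub
        ((measurable_sumLLR m).comp (measurable_history t))))
  have hpt : ∀ ω, ENNReal.ofReal (Real.exp ((declaresBefore Γ m n).indicator (fun _ => b) ω
        - stoppedLLR Γ f g m j n ω)) ≤
      (∑ t ∈ Finset.range n, F t (history t ω) * ENNReal.ofReal
        (Real.exp (sumLLR f g (history t ω) j - sumLLR f g (history t ω) m)))
      + S.indicator 1 (history n ω) * ENNReal.ofReal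
        (Real.exp (sumLLR f g (history n ω) j - sumLLR f g (history n ω) m)) := by
    intro ω
    by_cases hτ : (n : ℕ∞) ≤ Γ.τ ω
    · have h1 : ω ∉ declaresBefore Γ m n := by
        rintro ⟨t, ht, h2, -⟩
        rw [h2] at hτ
        exact absurd (Nat.cast_le.1 hτ) (not_le.2 ht)
      have h2 : history n ω ∈ S := history_mem_staySet_halt.2 hτ
      rw [Set.indicator_of_notMem h1, stoppedLLR_of_eq le_rfl (Or.inr ⟨rfl, hτ⟩),
        Set.indicator_of_mem h2, Pi.one_apply, one_mul, zero_sub, neg_sub]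
      exact le_add_self
    · obtain ⟨t, ht⟩ := ENat.ne_top_iff_exists.1 (ne_top_of_lt (not_le.1 hτ))
      have htn : t < n := by
        rw [← ht] at hτ
        exact_mod_cast not_le.1 hτ
      have h3 : history t ω ∈ Γ.stopSet t := Γ.history_mem_stopSet.2 ht.symm
      refine le_trans ?_ le_self_add
      refine le_trans (le_of_eq ?_) (Finset.single_le_sum (fun _ _ => zero_le)
        (Finset.mem_range.2 htn))
      rw [stoppedLLR_of_eq htn.le (Or.inl ht.symm), hF]
      simp only [Set.indicator_of_mem h3]
      by_cases hd : Γ.decide t (history t ω) = m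
      · rw [if_pos hd, Set.indicator_of_mem (show ω ∈ declaresBefore Γ m n from
          ⟨t, htn, ht.symm, hd⟩), ← ENNReal.ofReal_mul (Real.exp_pos _).le, ← Real.exp_add]
        congr 2
        ring
      · have h4 : ω ∉ declaresBefore Γ m n := by
          rintro ⟨k, -, hk, hk'⟩
          have : t = k := by exact_mod_cast ht.trans hk
          subst this
          exact hd hk'
        rw [if_neg hd, Set.indicator_of_notMem h4, one_mul, zero_sub, neg_sub]
  have hpt' : ∀ ω, (∑ t ∈ Finset.range n, F t (history t ω)) + S.indicator 1 (history n ω)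
      ≤ 1 + ENNReal.ofReal (Real.exp b) * (Γ.declares m).indicator 1 ω := by
    intro ω
    by_cases hτ : (n : ℕ∞) ≤ Γ.τ ω
    · have h1 : ∑ t ∈ Finset.range n, F t (history t ω) = 0 := by
        refine Finset.sum_eq_zero fun t ht => Set.indicator_of_notMem (fun h2 => ?_) _
        rw [Γ.history_mem_stopSet.1 h2] at hτ
        exact absurd (Nat.cast_le.1 hτ) (not_le.2 (Finset.mem_range.1 ht))
      rw [h1, zero_add]
      exact (Set.indicator_le_self' (fun _ _ => zero_le) _).trans le_self_add
    · have h2 : history n ω ∉ S := fun h => hτ (history_mem_staySet_halt.1 h)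
      obtain ⟨t, ht⟩ := ENat.ne_top_iff_exists.1 (ne_top_of_lt (not_le.1 hτ))
      have htn : t < n := by
        rw [← ht] at hτ
        exact_mod_cast not_le.1 hτ
      have h3 : history t ω ∈ Γ.stopSet t := Γ.history_mem_stopSet.2 ht.symm
      rw [Set.indicator_of_notMem h2, add_zero, Finset.sum_eq_single t]
      · simp only [hF, Set.indicator_of_mem h3]
        by_cases hd : Γ.decide t (history t ω) = m
        · rw [if_pos hd, Set.indicator_of_mem (show ω ∈ Γ.declares m from ⟨t, ht.symm, hd⟩),
            Pi.one_apply, mul_one]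
          exact le_add_self
        · rw [if_neg hd]
          exact le_self_add
      · intro k _ hk
        refine Set.indicator_of_notMem (fun h4 => hk ?_) _
        have := Γ.history_mem_stopSet.1 h4
        exact_mod_cast this.symm.trans ht.symm
      · intro h; exact absurd (Finset.mem_range.2 htn) h
  have hmF : ∀ t, Measurable fun ω : ℕ → Step M K Y => F t (history t ω) :=
    fun t => (hFm t).comp (measurable_history t)
  have hmS : Measurable fun ω : ℕ → Step M K Y =>
      S.indicator (1 : (Fin n → Step M K Y) → ℝ≥0∞) (history n ω) :=
    hSm'.comp (measurable_history n)
  have hmSE : Measurable fun ω : ℕ → Step M K Y =>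
      S.indicator (1 : (Fin n → Step M K Y) → ℝ≥0∞) (history n ω) * ENNReal.ofReal
        (Real.exp (sumLLR f g (history n ω) j - sumLLR f g (history n ω) m)) := hmS.mul (hE n)
  have hmFE : ∀ t, Measurable fun ω : ℕ → Step M K Y =>
      F t (history t ω) * ENNReal.ofReal
        (Real.exp (sumLLR f g (history t ω) j - sumLLR f g (history t ω) m)) :=
    fun t => (hmF t).mul (hE t)
  refine (lintegral_mono hpt).trans ?_
  rw [lintegral_add_right _ hmSE, lintegral_finsetSum _ fun t _ => hmFE t,
    ← lintegral_history_change Γ m hgf hfg j n hSm',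
    Finset.sum_congr rfl fun t _ => (lintegral_history_change Γ m hgf hfg j t (hFm t)).symm,
    ← lintegral_finsetSum _ fun t _ => hmF t, ← lintegral_add_right _ hmS]
  refine (lintegral_mono hpt').trans_eq ?_
  rw [lintegral_add_left measurable_const, lintegral_const_mul' _ _ ENNReal.ofReal_ne_top,
    lintegral_indicator_one (Γ.measurableSet_declares m), lintegral_const, measure_univ, mul_one]

lemma integrable_stoppedLLR (hgf : klDiv g f ≠ ∞) (hfg : klDiv f g ≠ ∞) (Γ : Strategy M K Y)
    {m j : Fin M} (hj : j ≠ m) (n : ℕ) :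
    Integrable (stoppedLLR Γ f g m j n) (Γ.law f g m) := by
  refine integrable_finsetSum _ fun t _ => ?_
  have h := (integral_step_le Γ m t (x := fun s => stepLLR f g s m - stepLLR f g s j)
    ((measurable_stepLLR m).sub (measurable_stepLLR j))
    (fun u => (integral_stepLLR_sub hgf hfg hj u).1) (fun u => Finset.single_le_sum
      (f := fun u => |∫ y, (stepLLR f g (u, y) m - stepLLR f g (u, y) j) ∂(obsLaw f g m u)|)
      (fun _ _ => abs_nonneg _) (Finset.mem_univ u) |>.trans' (le_abs_self _))
    (Γ.measurableSet_aliveSet t)).1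
  refine h.congr (ae_of_all _ fun ω => ?_)
  by_cases hω : (t : ℕ∞) < Γ.τ ω
  · simp [hω, Set.indicator_of_mem (Γ.history_mem_aliveSet.2 hω)]
  · simp [hω, Set.indicator_of_notMem fun h => hω (Γ.history_mem_aliveSet.1 h)]

/-- The expected log-likelihood ratio at the time `min τ n` is large if `m` is likely to be
declared under `H_m` and unlikely under `H_j`. This is a form of the data processing inequality,
obtained by integrating `x ≥ β + 1 - e^(β - x)` with `β = b` on the event that `m` is declared
and `β = 0` elsewhere. -/
lemma le_integral_stoppedLLR (hgf : klDiv g f ≠ ∞) (hfg : klDiv f g ≠ ∞) (Γ : Strategy M K Y)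
    {m j : Fin M} (hj : j ≠ m) (n : ℕ) {b : ℝ}
    (hb : ENNReal.ofReal (Real.exp b) * Γ.law f g j (Γ.declares m) ≤ 1) :
    b * (Γ.law f g m).real (declaresBefore Γ m n) - 1
      ≤ ∫ ω, stoppedLLR Γ f g m j n ω ∂(Γ.law f g m) := by
  set P := Γ.law f g m
  have hA := measurableSet_declaresBefore Γ m n
  set w : (ℕ → Step M K Y) → ℝ := (declaresBefore Γ m n).indicator fun _ => b with hw
  have hwm : Measurable w := measurable_const.indicator hA
  have hle := lintegral_exp_stoppedLLR_le (klDiv_ne_top_iff.1 hgf).1 (klDiv_ne_top_iff.1 hfg).1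
    Γ m j n b
  have h2 : ∫⁻ ω, ENNReal.ofReal (Real.exp (w ω - stoppedLLR Γ f g m j n ω)) ∂P ≤ 2 :=
    hle.trans ((add_le_add le_rfl hb).trans_eq one_add_one_eq_two)
  have hem : Measurable fun ω => Real.exp (w ω - stoppedLLR Γ f g m j n ω) :=
    Real.measurable_exp.comp (hwm.sub (measurable_stoppedLLR Γ m j n))
  have hnn : 0 ≤ᵐ[P] fun ω => Real.exp (w ω - stoppedLLR Γ f g m j n ω) :=
    ae_of_all _ fun ω => (Real.exp_pos _).le
  have heint : Integrable (fun ω => Real.exp (w ω - stoppedLLR Γ f g m j n ω)) P :=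
    (lintegral_ofReal_ne_top_iff_integrable hem.aestronglyMeasurable hnn).1
      (ne_top_of_le_ne_top (by simp) h2)
  have he2 : ∫ ω, Real.exp (w ω - stoppedLLR Γ f g m j n ω) ∂P ≤ 2 := by
    rw [integral_eq_lintegral_of_nonneg_ae hnn hem.aestronglyMeasurable]
    exact ENNReal.toReal_le_of_le_ofReal (by norm_num) (by simpa using h2)
  have hwint : Integrable w P := (integrable_const b).indicator hA
  have hwval : ∫ ω, w ω ∂P = b * P.real (declaresBefore Γ m n) := by
    rw [hw, integral_indicator_const _ hA, smul_eq_mul, mul_comm]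
  have h1int : Integrable (fun ω => w ω + 1) P := hwint.add (integrable_const 1)
  calc b * P.real (declaresBefore Γ m n) - 1
      ≤ ∫ ω, (w ω + 1 - Real.exp (w ω - stoppedLLR Γ f g m j n ω)) ∂P := by
        rw [integral_sub h1int heint, integral_add hwint (integrable_const 1), hwval]
        simp only [integral_const, smul_eq_mul, mul_one, probReal_univ]
        linarith
    _ ≤ ∫ ω, stoppedLLR Γ f g m j n ω ∂P := by
        refine integral_mono (h1int.sub heint) (integrable_stoppedLLR hgf hfg Γ hj n) fun ω => ?_
        have := Real.add_one_le_exp (w ω - stoppedLLR Γ f g m j n ω)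
        change w ω + 1 - Real.exp (w ω - stoppedLLR Γ f g m j n ω) ≤ _
        linarith

/-- Averaged over the alternatives `j ≠ m`, no strategy gathers more information per time step
than the rate. -/
lemma sum_integral_stoppedLLR_le (hM : 2 ≤ M) (hgf : klDiv g f ≠ ∞) (hfg : klDiv f g ≠ ∞)
    (Γ : Strategy M K Y) (m : Fin M) (n : ℕ) :
    ∑ j ∈ Finset.univ.erase m, ∫ ω, stoppedLLR Γ f g m j n ω ∂(Γ.law f g m)
      ≤ (M - 1) * rate f g M K *
        ∑ t ∈ Finset.range n, (Γ.law f g m).real {ω | (t : ℕ∞) < Γ.τ ω} := by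
  set P := Γ.law f g m
  have hM1 : (0 : ℝ) < M - 1 := natCast_sub_one_pos hM
  have hcard := card_univ_erase hM m
  set x : Step M K Y → ℝ := fun s =>
    ∑ j ∈ Finset.univ.erase m, (stepLLR f g s m - stepLLR f g s j) with hx
  have hxm : Measurable x := Finset.measurable_sum _ fun j _ =>
    (measurable_stepLLR m).sub (measurable_stepLLR j)
  have hxint : ∀ u, Integrable (fun y => x (u, y)) (obsLaw f g m u) := fun u =>
    integrable_finsetSum _ fun j hj =>
      (integral_stepLLR_sub hgf hfg (Finset.ne_of_mem_erase hj) u).1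
  have hxD : ∀ u, ∫ y, x (u, y) ∂(obsLaw f g m u) ≤ (M - 1) * rate f g M K := by
    intro u
    rw [hx, integral_finsetSum _ fun j hj =>
      (integral_stepLLR_sub hgf hfg (Finset.ne_of_mem_erase hj) u).1,
      Finset.sum_congr rfl fun j hj =>
        (integral_stepLLR_sub hgf hfg (Finset.ne_of_mem_erase hj) u).2,
      Finset.sum_add_distrib, Finset.sum_const, nsmul_eq_mul, hcard, ← Finset.sum_mul,
      sum_occ_erase]
    have h := mul_le_mul_of_nonneg_left (average_le_rate (f := f) (g := g) hM u m) hM1.le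
    rw [mul_add, mul_div_cancel₀ _ hM1.ne'] at h
    exact h
  have hstep := fun t => integral_step_le Γ m t hxm hxint hxD (Γ.measurableSet_aliveSet t)
  have hsum : ∀ ω, ∑ j ∈ Finset.univ.erase m, stoppedLLR Γ f g m j n ω
      = ∑ t ∈ Finset.range n, (Γ.aliveSet t).indicator 1 (history t ω) * x (ω t) := by
    intro ω
    unfold stoppedLLR
    rw [Finset.sum_comm]
    refine Finset.sum_congr rfl fun t _ => ?_
    by_cases hω : (t : ℕ∞) < Γ.τ ω
    · simp [hω, Set.indicator_of_mem (Γ.history_mem_aliveSet.2 hω), hx]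
    · simp [hω, Set.indicator_of_notMem fun h => hω (Γ.history_mem_aliveSet.1 h)]
  rw [← integral_finsetSum _ fun j hj =>
    integrable_stoppedLLR hgf hfg Γ (Finset.ne_of_mem_erase hj) n, integral_congr_ae
    (ae_of_all _ hsum), integral_finsetSum _ fun t _ => (hstep t).1, Finset.mul_sum]
  refine Finset.sum_le_sum fun t _ => ((hstep t).2).trans_eq ?_
  congr 2
  ext ω
  exact Γ.history_mem_aliveSet

/-- The information bound: a strategy that declares `m` with high probability under `H_m` and with
probability at most `e^(-b)` under every other hypothesis needs a time of about `b / I*`. -/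
lemma le_rate_mul_expectedTime (hM : 2 ≤ M) (hgf : klDiv g f ≠ ∞) (hfg : klDiv f g ≠ ∞)
    (Γ : Strategy M K Y) (m : Fin M) {b : ℝ} (hI : 0 ≤ rate f g M K)
    (hb : ∀ j, j ≠ m → ENNReal.ofReal (Real.exp b) * Γ.law f g j (Γ.declares m) ≤ 1)
    (hτ : Γ.expectedTime f g m ≠ ∞) :
    b * (Γ.law f g m).real (Γ.declares m) - 1
      ≤ rate f g M K * (Γ.expectedTime f g m).toReal := by
  set P := Γ.law f g m
  have hM1 : (0 : ℝ) < M - 1 := natCast_sub_one_pos hM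
  have hcard := card_univ_erase hM m
  have hn : ∀ n, b * P.real (declaresBefore Γ m n) - 1
      ≤ rate f g M K * (Γ.expectedTime f g m).toReal := by
    intro n
    have h1 : (M - 1 : ℝ) * (b * P.real (declaresBefore Γ m n) - 1)
        ≤ ∑ j ∈ Finset.univ.erase m, ∫ ω, stoppedLLR Γ f g m j n ω ∂P := by
      rw [← hcard, ← nsmul_eq_mul]
      exact Finset.card_nsmul_le_sum _ _ _ fun j hj =>
        le_integral_stoppedLLR hgf hfg Γ (Finset.ne_of_mem_erase hj) n
          (hb j (Finset.ne_of_mem_erase hj))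
    have h2 : ∑ t ∈ Finset.range n, P.real {ω | (t : ℕ∞) < Γ.τ ω}
        ≤ (Γ.expectedTime f g m).toReal := by
      rw [← ENNReal.ofReal_le_iff_le_toReal hτ, ENNReal.ofReal_sum_of_nonneg
        fun _ _ => measureReal_nonneg, Γ.expectedTime_eq_tsum,
        Finset.sum_congr rfl fun t _ => ofReal_measureReal]
      exact ENNReal.sum_le_tsum _
    have h3 := h1.trans (sum_integral_stoppedLLR_le hM hgf hfg Γ m n)
    rw [mul_assoc] at h3
    exact (le_of_mul_le_mul_left h3 hM1).trans (mul_le_mul_of_nonneg_left h2 hI)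
  have hlim : Tendsto (fun n => b * P.real (declaresBefore Γ m n) - 1) atTop
      (𝓝 (b * P.real (Γ.declares m) - 1)) := by
    refine Tendsto.sub_const (Tendsto.const_mul b ?_) 1
    exact (ENNReal.tendsto_toReal (measure_ne_top P _)).comp
      (tendsto_measure_declaresBefore Γ m P)
  exact le_of_tendsto' hlim hn

end

section

/-! ### Asymptotics of the Bayes risk -/

lemma tendsto_div_ofReal_one {ι : Type*} {l : Filter ι} {R : ι → ℝ≥0∞} {x : ι → ℝ}
    (hx : ∀ᶠ c in l, 0 < x c)
    (hR : ∀ ε : ℝ, 0 < ε → ε < 1 → ∀ᶠ c in l,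
      ENNReal.ofReal ((1 - ε) * x c) ≤ R c ∧ R c ≤ ENNReal.ofReal ((1 + ε) * x c)) :
    Tendsto (fun c => R c / ENNReal.ofReal (x c)) l (𝓝 1) := by
  refine (ENNReal.tendsto_nhds ENNReal.one_ne_top).2 fun η hη => ?_
  obtain ⟨ε, hε0, hε1, hεη⟩ : ∃ ε : ℝ, 0 < ε ∧ ε < 1 ∧ ENNReal.ofReal ε ≤ η := by
    rcases eq_or_ne η ∞ with rfl | h
    · exact ⟨1 / 2, by norm_num, by norm_num, le_top⟩
    · have h1 : 0 < η.toReal := ENNReal.toReal_pos hη.ne' h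
      refine ⟨min η.toReal (1 / 2), by positivity, (min_le_right _ _).trans_lt (by norm_num), ?_⟩
      exact ENNReal.ofReal_le_of_le_toReal (min_le_left _ _)
  filter_upwards [hx, hR ε hε0 hε1] with c hc ⟨h1, h2⟩
  have hc0 : ENNReal.ofReal (x c) ≠ 0 := by simpa using hc
  rw [ENNReal.ofReal_mul (by linarith)] at h1 h2
  constructor
  · refine le_trans ?_ ((ENNReal.le_div_iff_mul_le (Or.inl hc0)
      (Or.inl ENNReal.ofReal_ne_top)).2 h1)
    rw [ENNReal.ofReal_sub _ hε0.le, ENNReal.ofReal_one]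
    exact tsub_le_tsub_left hεη 1
  · refine (ENNReal.div_le_of_le_mul h2).trans ?_
    rw [ENNReal.ofReal_add zero_le_one hε0.le, ENNReal.ofReal_one]
    exact add_le_add le_rfl hεη

lemma tendsto_neg_log_nhdsGT_zero : Tendsto (fun c : ℝ => -Real.log c) (𝓝[>] 0) atTop :=
  tendsto_neg_atBot_atTop.comp Real.tendsto_log_nhdsGT_zero

lemma tendsto_neg_mul_log_nhdsGT_zero (I : ℝ) :
    Tendsto (fun c : ℝ => -c * Real.log c / I) (𝓝[>] 0) (𝓝 0) := by
  have h := ((Real.continuous_mul_log.tendsto 0).mono_left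
    (nhdsWithin_le_nhds (s := Set.Ioi 0))).neg.div_const I
  simp only [zero_mul, neg_zero, zero_div] at h
  refine h.congr fun c => ?_
  ring

/-- With `x = -c log c / I`, the lower bound `log (p / x) (1 - x / p) - 1` for `I` times the
expected detection time is asymptotically `-log c`. -/
lemma eventually_le_log_mul {I p ε : ℝ} (hI : 0 < I) (hp : 0 < p) (hε : 0 < ε) :
    ∀ᶠ c : ℝ in 𝓝[>] 0, (1 - ε) * -Real.log c ≤
      Real.log (p / (-c * Real.log c / I)) * (1 - -c * Real.log c / I / p) - 1 := by
  have hx := (tendsto_neg_mul_log_nhdsGT_zero I).div_const p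
  rw [zero_div] at hx
  have hL := tendsto_neg_log_nhdsGT_zero
  have hlogL : Tendsto (fun c : ℝ => Real.log (-Real.log c) / -Real.log c) (𝓝[>] 0) (𝓝 0) :=
    (Real.isLittleO_log_id_atTop.tendsto_div_nhds_zero).comp hL
  have hinv : Tendsto (fun c : ℝ => (-Real.log c)⁻¹) (𝓝[>] 0) (𝓝 0) :=
    tendsto_inv_atTop_zero.comp hL
  have hlim : Tendsto (fun c : ℝ => (1 - Real.log (-Real.log c) / -Real.log c
      + Real.log (p * I) * (-Real.log c)⁻¹) * (1 - -c * Real.log c / I / p)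
      - (-Real.log c)⁻¹) (𝓝[>] 0) (𝓝 1) := by
    have h := (((tendsto_const_nhds (x := (1 : ℝ))).sub hlogL).add
      (hinv.const_mul (Real.log (p * I)))).mul ((tendsto_const_nhds (x := (1 : ℝ))).sub hx)
    simpa using h.sub hinv
  filter_upwards [hlim.eventually_const_lt (show 1 - ε < 1 by linarith),
    hL.eventually_gt_atTop 0, self_mem_nhdsWithin] with c h1 h2 hc
  have hc0 : 0 < c := hc
  have hlog : Real.log (p / (-c * Real.log c / I))
      = -Real.log c - Real.log (-Real.log c) + Real.log (p * I) := by
    have h3 : p / (-c * Real.log c / I) = p * I / (c * -Real.log c) := by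
      rw [div_div_eq_mul_div]
      congr 1
      ring
    rw [h3, Real.log_div (by positivity) (by positivity), Real.log_mul hc0.ne' h2.ne']
    ring
  rw [hlog]
  have h4 := (mul_lt_mul_of_pos_right h1 h2).le
  refine h4.trans_eq ?_
  set L := -Real.log c
  field_simp

variable {M K : ℕ} {Y : Type*} [MeasurableSpace Y] {f g : Measure Y}
  [IsProbabilityMeasure f] [IsProbabilityMeasure g]

/-- The Bayes risk of the Chernoff test is at most `(1 + ε) (-c log c) / I*` for small costs. -/
lemma eventually_risk_le (hM : 2 ≤ M) (hK : 1 ≤ K) (hKM : K ≤ M) (hne : f ≠ g)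
    (hgf : klDiv g f ≠ ∞) (hfg : klDiv f g ≠ ∞) {π : Fin M → ℝ} (hπ : ∀ m, 0 < π m)
    (hπ_sum : ∑ m, π m = 1) {ε : ℝ} (hε : 0 < ε) :
    ∀ᶠ c : ℝ in 𝓝[>] 0, ∀ Γ : Strategy M K Y, IsChernoffTest f g c Γ →
      Γ.risk f g π c ≤ ENNReal.ofReal ((1 + ε) * (-c * Real.log c / rate f g M K)) := by
  set I := rate f g M K
  have hI : 0 < I := rate_pos hM hK hne hgf hfg
  set β := I / (1 + ε / 2) with hβ
  have hβ0 : 0 < β := by positivity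
  have hβI : β < I := div_lt_self hI (by linarith)
  obtain ⟨C, hC0, hC⟩ := exists_expectedTime_le hM hK hKM hne hgf hfg hβ0 hβI
  have hac := (klDiv_ne_top_iff.1 hgf).1
  have hac' := (klDiv_ne_top_iff.1 hfg).1
  have hc1 : ∀ᶠ c : ℝ in 𝓝[>] 0, c < 1 := nhdsWithin_le_nhds (Iio_mem_nhds one_pos)
  filter_upwards [hc1, self_mem_nhdsWithin,
    tendsto_neg_log_nhdsGT_zero.eventually_ge_atTop ((M + C) * I / (ε / 2))] with c hc1 hc0 hL Γ hCT
  replace hc0 : 0 < c := hc0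
  set L := -Real.log c with hLdef
  have hL0 : 0 ≤ L := le_trans (by positivity) hL
  rw [div_le_iff₀ (by positivity)] at hL
  have hterm : ∀ m, Γ.errorProb f g m + ENNReal.ofReal c * Γ.expectedTime f g m
      ≤ ENNReal.ofReal (M * c + c * (L / β + C)) := by
    intro m
    have h1 := hC c hc0 hc1 Γ hCT m
    have h2 := hCT.errorProb_le hc0 hc1 hM hac hac' (ne_top_of_le_ne_top ENNReal.ofReal_ne_top h1)
    rw [ENNReal.ofReal_add (by positivity) (by positivity), ENNReal.ofReal_mul hc0.le]
    exact add_le_add h2 (mul_le_mul_right h1 _)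
  have hsum : ∑ m, ENNReal.ofReal (π m) = 1 := by
    rw [← ENNReal.ofReal_sum_of_nonneg fun m _ => (hπ m).le, hπ_sum, ENNReal.ofReal_one]
  calc Γ.risk f g π c
      ≤ ∑ m, ENNReal.ofReal (π m) * ENNReal.ofReal (M * c + c * (L / β + C)) :=
        Finset.sum_le_sum fun m _ => mul_le_mul_right (hterm m) _
    _ = ENNReal.ofReal (M * c + c * (L / β + C)) := by rw [← Finset.sum_mul, hsum, one_mul]
    _ ≤ ENNReal.ofReal ((1 + ε) * (-c * Real.log c / I)) := by
        refine ENNReal.ofReal_le_ofReal ?_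
        have h1 : L / β = (1 + ε / 2) * (L / I) := by rw [hβ]; field_simp
        have h2 : M + C ≤ ε / 2 * (L / I) := by
          rw [← mul_div_assoc, le_div_iff₀ hI]
          linarith
        have h3 : -c * Real.log c / I = c * (L / I) := by rw [hLdef]; ring
        rw [h1, h3]
        nlinarith [mul_le_mul_of_nonneg_left h2 hc0.le]

/-- The Bayes risk of any strategy is at least `(1 - ε) (-c log c) / I*` for small costs. A
strategy with a smaller risk has error probabilities of the order `-c log c`, so that the
information bound gives an expected detection time of at least `(1 - ε) (-log c) / I*`. -/
lemma eventually_le_risk (hM : 2 ≤ M) (hK : 1 ≤ K) (hne : f ≠ g)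
    (hgf : klDiv g f ≠ ∞) (hfg : klDiv f g ≠ ∞) {π : Fin M → ℝ} (hπ : ∀ m, 0 < π m)
    (hπ_sum : ∑ m, π m = 1) {ε : ℝ} (hε : 0 < ε) :
    ∀ᶠ c : ℝ in 𝓝[>] 0, ∀ Γ : Strategy M K Y,
      ENNReal.ofReal ((1 - ε) * (-c * Real.log c / rate f g M K)) ≤ Γ.risk f g π c := by
  set I := rate f g M K
  have hI : 0 < I := rate_pos hM hK hne hgf hfg
  have : Nonempty (Fin M) := ⟨⟨0, by omega⟩⟩
  obtain ⟨m₀, hm₀⟩ := Finite.exists_min π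
  set p := π m₀
  have hp : 0 < p := hπ m₀
  have hxp : ∀ᶠ c : ℝ in 𝓝[>] 0, -c * Real.log c / I < p :=
    (tendsto_neg_mul_log_nhdsGT_zero I).eventually_lt_const hp
  filter_upwards [hxp, self_mem_nhdsWithin, eventually_le_log_mul hI hp hε,
    tendsto_neg_log_nhdsGT_zero.eventually_gt_atTop 0] with c hxp hc0 hlog hL Γ
  replace hc0 : 0 < c := hc0
  set x := -c * Real.log c / I with hx
  have hxL : x = c * (-Real.log c / I) := by rw [hx]; ring
  have hx0 : 0 < x := by rw [hxL]; positivity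
  by_contra hlt
  rw [not_le] at hlt
  have hlt' : Γ.risk f g π c < ENNReal.ofReal x :=
    hlt.trans_le (ENNReal.ofReal_le_ofReal (by nlinarith))
  have hterm : ∀ m, ENNReal.ofReal (π m) *
      (Γ.errorProb f g m + ENNReal.ofReal c * Γ.expectedTime f g m) ≤ ENNReal.ofReal x := fun m =>
    (Finset.single_le_sum (f := fun m => ENNReal.ofReal (π m) *
      (Γ.errorProb f g m + ENNReal.ofReal c * Γ.expectedTime f g m))
      (fun _ _ => zero_le) (Finset.mem_univ m)).trans hlt'.le
  have herr : ∀ m, Γ.errorProb f g m ≤ ENNReal.ofReal (x / p) := by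
    intro m
    rw [ENNReal.ofReal_div_of_pos hp, ENNReal.le_div_iff_mul_le (Or.inl (by simpa using hp))
      (Or.inl ENNReal.ofReal_ne_top), mul_comm]
    calc ENNReal.ofReal p * Γ.errorProb f g m
        ≤ ENNReal.ofReal (π m) *
          (Γ.errorProb f g m + ENNReal.ofReal c * Γ.expectedTime f g m) :=
          mul_le_mul' (ENNReal.ofReal_le_ofReal (hm₀ m)) le_self_add
      _ ≤ ENNReal.ofReal x := hterm m
  have hτ : ∀ m, Γ.expectedTime f g m ≠ ∞ := by
    intro m h
    have h1 := hterm m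
    rw [h, ENNReal.mul_top (by simpa using hc0), add_top, ENNReal.mul_top
      (by simpa using hπ m)] at h1
    exact ENNReal.ofReal_ne_top (top_le_iff.1 h1)
  have htime : ∀ m, (1 - ε) * (-Real.log c / I) ≤ (Γ.expectedTime f g m).toReal := by
    intro m
    set b := Real.log (p / x) with hb
    have hb0 : 0 ≤ b := Real.log_nonneg (by rw [le_div_iff₀ hx0]; linarith)
    have hbj : ∀ j, j ≠ m → ENNReal.ofReal (Real.exp b) * Γ.law f g j (Γ.declares m) ≤ 1 := by
      intro j hj
      have h1 : Γ.law f g j (Γ.declares m) ≤ Γ.errorProb f g j := by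
        refine measure_mono ?_
        rintro ω ⟨n, hn, hd⟩ ⟨k, hk, hd'⟩
        have hnk : n = k := by exact_mod_cast hn.symm.trans hk
        subst hnk
        exact hj (hd'.symm.trans hd)
      calc ENNReal.ofReal (Real.exp b) * Γ.law f g j (Γ.declares m)
          ≤ ENNReal.ofReal (p / x) * ENNReal.ofReal (x / p) := by
            rw [hb, Real.exp_log (by positivity)]
            exact mul_le_mul_right (h1.trans (herr j)) _
        _ = 1 := by
            rw [← ENNReal.ofReal_mul (by positivity), div_mul_div_cancel₀ hx0.ne', div_self hp.ne',
              ENNReal.ofReal_one]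
    have h1 := le_rate_mul_expectedTime hM hgf hfg Γ m hI.le hbj (hτ m)
    have h2 : 1 - x / p ≤ (Γ.law f g m).real (Γ.declares m) := by
      have h3 := probReal_compl_eq_one_sub (μ := Γ.law f g m) (Γ.measurableSet_declares m)
      have h4 : (Γ.law f g m).real (Γ.declares m)ᶜ ≤ x / p :=
        ENNReal.toReal_le_of_le_ofReal (by positivity) (herr m)
      linarith
    have h5 : (1 - ε) * -Real.log c ≤ I * (Γ.expectedTime f g m).toReal := by
      have h6 := mul_le_mul_of_nonneg_left h2 hb0
      linarith
    rw [← mul_div_assoc, div_le_iff₀ hI]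
    linarith
  refine absurd hlt (not_lt.2 ?_)
  have hsum : ∑ m, ENNReal.ofReal (π m) = 1 := by
    rw [← ENNReal.ofReal_sum_of_nonneg fun m _ => (hπ m).le, hπ_sum, ENNReal.ofReal_one]
  calc ENNReal.ofReal ((1 - ε) * x)
      = ∑ m, ENNReal.ofReal (π m) *
          (ENNReal.ofReal c * ENNReal.ofReal ((1 - ε) * (-Real.log c / I))) := by
        rw [← Finset.sum_mul, hsum, one_mul, ← ENNReal.ofReal_mul hc0.le, hxL]
        congr 1
        ring
    _ ≤ Γ.risk f g π c := by
        refine Finset.sum_le_sum fun m _ => mul_le_mul_right (le_trans ?_ le_add_self) _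
        exact mul_le_mul_right (ENNReal.ofReal_le_of_le_toReal (htime m)) _

end

end AnomalyDetection

theorem theorem2 {Y : Type*} [MeasurableSpace Y] (M K : ℕ) (hK : 1 ≤ K) (hKM : K ≤ M)
    (π : Fin M → ℝ) (hπ : ∀ m, 0 < π m ∧ π m < 1) (hπ_sum : ∑ m, π m = 1)
    (f g : Measure Y) [IsProbabilityMeasure f] [IsProbabilityMeasure g] (hfg : f ≠ g)
    (hgf_fin : klDiv g f ≠ ∞) (hfg_fin : klDiv f g ≠ ∞) :
    -- Chernoff tests exist
    (∀ c : ℝ, 0 < c → c < 1 →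
      ∃ Γ : AnomalyDetection.Strategy M K Y, AnomalyDetection.IsChernoffTest f g c Γ) ∧
    -- the risk of the Chernoff test is asymptotically `-c log c / I*(M,K)`
    (∀ CT : ℝ → AnomalyDetection.Strategy M K Y,
      (∀ c : ℝ, 0 < c → c < 1 → AnomalyDetection.IsChernoffTest f g c (CT c)) →
      Tendsto (fun c : ℝ => (CT c).risk f g π c /
          ENNReal.ofReal (-c * Real.log c / AnomalyDetection.rate f g M K))
        (𝓝[>] 0) (𝓝 1)) ∧
    -- and so is the infimum of the risks of all strategies
    Tendsto (fun c : ℝ =>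
        ENNReal.ofReal (-c * Real.log c / AnomalyDetection.rate f g M K) /
          ⨅ Γ : AnomalyDetection.Strategy M K Y, Γ.risk f g π c)
      (𝓝[>] 0) (𝓝 1) := by
  open AnomalyDetection in
  -- a single cell would have prior probability `1`
  have hM : 2 ≤ M := by
    by_contra h
    have h1 : M = 1 := by omega
    subst h1
    have h2 := (hπ 0).2
    simp at hπ_sum
    exact absurd hπ_sum h2.ne
  have hπ0 : ∀ m, 0 < π m := fun m => (hπ m).1
  have hexists : ∀ c : ℝ, ∃ Γ : Strategy M K Y, IsChernoffTest f g c Γ :=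
    exists_isChernoffTest hM hK hKM hgf_fin hfg_fin
  have hI : 0 < rate f g M K := rate_pos hM hK hfg hgf_fin hfg_fin
  have hc : ∀ᶠ c : ℝ in 𝓝[>] 0, 0 < c ∧ c < 1 := Ioo_mem_nhdsGT one_pos
  have hx : ∀ᶠ c : ℝ in 𝓝[>] 0, 0 < -c * Real.log c / rate f g M K := by
    filter_upwards [hc] with c hc
    have := Real.log_neg hc.1 hc.2
    exact div_pos (by nlinarith [hc.1]) hI
  refine ⟨fun c _ _ => hexists c, fun CT hCT => ?_, ?_⟩
  · refine tendsto_div_ofReal_one hx fun ε hε _ => ?_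
    filter_upwards [hc, eventually_risk_le hM hK hKM hfg hgf_fin hfg_fin hπ0 hπ_sum hε,
      eventually_le_risk hM hK hfg hgf_fin hfg_fin hπ0 hπ_sum hε] with c hc h1 h2
    exact ⟨h2 _, h1 _ (hCT c hc.1 hc.2)⟩
  · have h : Tendsto (fun c : ℝ => (⨅ Γ : Strategy M K Y, Γ.risk f g π c) /
        ENNReal.ofReal (-c * Real.log c / rate f g M K)) (𝓝[>] 0) (𝓝 1) := by
      refine tendsto_div_ofReal_one hx fun ε hε _ => ?_
      filter_upwards [eventually_risk_le hM hK hKM hfg hgf_fin hfg_fin hπ0 hπ_sum hε,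
        eventually_le_risk hM hK hfg hgf_fin hfg_fin hπ0 hπ_sum hε] with c h1 h2
      obtain ⟨Γ, hΓ⟩ := hexists c
      exact ⟨le_iInf h2, (iInf_le _ Γ).trans (h1 Γ hΓ)⟩
    have h' := h.inv
    rw [inv_one] at h'
    refine h'.congr' ?_
    filter_upwards [hx] with c hc
    exact ENNReal.inv_div (Or.inl ENNReal.ofReal_ne_top) (Or.inl (by simpa using hc))
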